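/- Let $K,N,M,d$ be natural numbers with $d\ge 1$ and $(K-1)N>M$. A channel is a family $H=(\mathbf H_{ij})_{1\le i,j\le K}$ of complex $N\times M$ matrices ($\mathbf H_{ij}$ from base station (BS) $j$ to user $i$). Assume interference alignment (IA) is feasible: for Lebesgue-almost every $H$ there are $\mathbf U_i\in\mathbb C^{N\times d}$, $\mathbf V_j\in\mathbb C^{M\times d}$ with $\mathbf U_i^{\mathrm H}\mathbf H_{ij}\mathbf V_j=0$ for $j\ne i$ and $\operatorname{rank}(\mathbf U_i^{\mathrm H}\mathbf H_{ii}\mathbf V_i)=d$ for all $i$. Call a matrix truncated unitary if its columns are orthonormal, and let $d_c(\mathbf X,\mathbf Y)=\tfrac1{\sqrt2}\|\mathbf X\mathbf X^{\mathrm H}-\mathbf Y\mathbf Y^{\mathrm H}\|_{\mathrm F}$ be the chordal distance of the column spaces of truncated unitary $\mathbf X,\mathbf Y$. **Scheme.** For each number $n$ of bits, each BS $j$ has a codebook of $2^n$ truncated unitary $(K-1)N\times M$ matrices and the central node has, for each $j$, a codebook of $2^n$ truncated unitary $M\times d$ matrices. Each codebook is a Grassmannian subspace packing: for some $\delta$,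 distinct codewords are at chordal distance at least $\delta$, and every subspace of the given dimension is within $\delta$ of some codeword. Let $\mathbf H_j$ be the vertical stack of the $\mathbf H_{ij}$, $i\neq j$, factored as $\mathbf H_j=\mathbf F_j\mathbf C_j$ with $\mathbf F_j$ truncated unitary and $\mathbf C_j$ of size $M\times M$ (e.g. by a QR decomposition). At power $P\ge1$, BS $j$ quantizes $\mathbf F_j$ to a nearest codeword $\hat{\mathbf F}_j$ using $N_b=\lfloor\tfrac{G_b}{2}\log_2P\rfloor$ bits, $G_b=2M((K-1)N-M)$. From $(\hat{\mathbf F}_j)_j$ alone, the central node computes, by a fixed rule, truncated unitary $\tilde{\mathbf U}_i\in\mathbb C^{N\times d}$, $\tilde{\mathbf V}_j\in\mathbb C^{M\times d}$ with $\tilde{\mathbf U}_{-j}^{\mathrm H}\hat{\mathbf F}_j\tilde{\mathbf V}_j=0$ for all $j$, where $\tilde{\mathbf U}_{-j}$ is the block diagonal matrix of the $\tilde{\mathbf U}_i$, $i\ne j$. It quantizes $\tilde{\mathbf V}_j$ to a nearest codeword $\hat{\mathbf V}_j$ using $N_c=\lfloor\tfrac{G_c}{2}\log_2P\rfloor$ bits,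 $G_c=2d(M-d)$. BS $j$ uses the precoder $\mathbf V_j=\mathbf C_j^{-1}\mathbf F_j^{\mathrm H}\hat{\mathbf F}_j\hat{\mathbf V}_j$ and user $i$ the filter $\tilde{\mathbf U}_i$. Put $\mathbf Q_I^i=\sum_{j\ne i}\tilde{\mathbf U}_i^{\mathrm H}\mathbf H_{ij}\mathbf V_j\mathbf V_j^{\mathrm H}\mathbf H_{ij}^{\mathrm H}\tilde{\mathbf U}_i$, $\mathbf Q_S^i=\tilde{\mathbf U}_i^{\mathrm H}\mathbf H_{ii}\mathbf V_i\mathbf V_i^{\mathrm H}\mathbf H_{ii}^{\mathrm H}\tilde{\mathbf U}_i$; the leakage power at user $i$ is $L_i=\operatorname{tr}(\tfrac Pd\mathbf Q_I^i)$ and its achievable rate is $R_q^i=\log_2|\mathbf I_d+\tfrac Pd(\mathbf Q_S^i+\mathbf Q_I^i)|-\log_2|\mathbf I_d+\tfrac Pd\mathbf Q_I^i|$. **Theorem.** (1) Such schemes exist; moreover one exists in which every codebook has the largest minimum chordal distance possible for its size. (2) There is a constant $c_0$ such that for every such scheme and Lebesgue-almost every channel $H$ (hence almost surely when the distribution of $H$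 has a density), whatever factorizations $\mathbf H_j=\mathbf F_j\mathbf C_j$ are used, one has for every user $i$: $L_i\le c_0$ for all $P\ge1$, and $\lim_{P\to\infty}R_q^i/\log_2P$ exists and equals $d$ (in particular it is $\ge d$). (3) This is the degrees of freedom of IA under perfect CSI: for every channel $H$ and all truncated unitary $\mathbf U_i,\mathbf V_j$ with $\mathbf U_i^{\mathrm H}\mathbf H_{ij}\mathbf V_j=0$ for $j\neq i$ and $\operatorname{rank}(\mathbf U_i^{\mathrm H}\mathbf H_{ii}\mathbf V_i)=d$ for all $i$, the rate of each user $i$ given by the formula above with $(\mathbf U,\mathbf V)$ in place of $(\tilde{\mathbf U},\mathbf V)$ satisfies $\lim_{P\to\infty}R^i/\log_2P=d$. -/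

import Mathlib

open MeasureTheory Filter Topology
open scoped Matrix

noncomputable section

namespace CSITSharing

/-! ### Truncated unitary matrices, chordal distance, Grassmannian codebooks -/

/-- A truncated unitary matrix: its columns are orthonormal. Such matrices represent the points of
the Grassmann manifold of `p`-dimensional subspaces (via their column space). -/
def TruncatedUnitary {r : Type*} [Fintype r] {p : ℕ} (X : Matrix r (Fin p) ℂ) : Prop :=
  Xᴴ * X = 1

/-- Frobenius norm. -/
def frob {r s : Type*} [Fintype r] [Fintype s] (A : Matrix r s ℂ) : ℝ :=
  Real.sqrt (∑ a, ∑ b, ‖A a b‖ ^ 2)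

/-- Chordal distance `‖X Xᴴ - Y Yᴴ‖_F / √2` between the column spaces of truncated unitary
matrices. -/
def chordalDist {r : Type*} [Fintype r] {p : ℕ} (X Y : Matrix r (Fin p) ℂ) : ℝ :=
  1 / Real.sqrt 2 * frob (X * Xᴴ - Y * Yᴴ)

/-- Real dimension of the Grassmann manifold of `p`-dimensional subspaces of `ℂⁿ`. -/
def grassmannDim (n p : ℕ) : ℕ := 2 * p * (n - p)

/-- A Grassmannian subspace packing: truncated unitary codewords with pairwise chordal distance at
least `δ`, saturated in the sense that no subspace is at distance more than `δ` from all
codewords. -/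
def IsSubspacePacking {r : Type*} [Fintype r] {p m : ℕ}
    (code : Fin m → Matrix r (Fin p) ℂ) : Prop :=
  (∀ a, TruncatedUnitary (code a)) ∧
    ∃ δ : ℝ, (∀ a b, a ≠ b → δ ≤ chordalDist (code a) (code b)) ∧
      ∀ X : Matrix r (Fin p) ℂ, TruncatedUnitary X → ∃ a, chordalDist (code a) X ≤ δ

/-- A codebook whose minimum chordal distance is the largest possible for its size. -/
def IsMaxMinOptimal {r : Type*} [Fintype r] {p m : ℕ}
    (code : Fin m → Matrix r (Fin p) ℂ) : Prop :=
  ∀ code' : Fin m → Matrix r (Fin p) ℂ, (∀ a, TruncatedUnitary (code' a)) →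
    ∀ δ : ℝ, (∀ a b, a ≠ b → δ ≤ chordalDist (code' a) (code' b)) →
      ∀ a b, a ≠ b → δ ≤ chordalDist (code a) (code b)

/-- A quantizer on a Grassmann manifold: for each number `n` of bits, a codebook of `2 ^ n`
codewords designed by subspace packing, and a map that selects a codeword nearest in chordal
distance (with an arbitrary rule for ties). -/
structure Quantizer (r : Type*) [Fintype r] (p : ℕ) where
  code : (n : ℕ) → Fin (2 ^ n) → Matrix r (Fin p) ℂ
  packing : ∀ n, IsSubspacePacking (code n)
  index : (n : ℕ) → Matrix r (Fin p) ℂ → Fin (2 ^ n)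
  nearest : ∀ n X a, chordalDist (code n (index n X)) X ≤ chordalDist (code n a) X

/-- The quantized version of `X`, using `n` bits. -/
def Quantizer.quantize {r : Type*} [Fintype r] {p : ℕ} (q : Quantizer r p) (n : ℕ)
    (X : Matrix r (Fin p) ℂ) : Matrix r (Fin p) ℂ :=
  q.code n (q.index n X)

/-! ### The interference channel and interference alignment -/

/-- All channel coefficients; `H i j` holds the entries of the `N × M` channel from base station
`j` to user `i`. It carries Lebesgue measure as its `volume`. -/
abbrev Channel (K N M : ℕ) : Type := Fin K → Fin K → Fin N → Fin M → ℂ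

variable {K N M d : ℕ}

/-- The channel matrix from base station `j` to user `i`. -/
def Channel.mat (H : Channel K N M) (i j : Fin K) : Matrix (Fin N) (Fin M) ℂ :=
  Matrix.of (H i j)

/-- Row index set of the stacked cross-channel matrix of base station `j`; it has
`(K - 1) N` elements. -/
abbrev CrossRows (N : ℕ) (j : Fin K) : Type := Fin N × {i : Fin K // i ≠ j}

/-- The stacked cross-channel matrix of base station `j`. -/
def Channel.stack (H : Channel K N M) (j : Fin K) : Matrix (CrossRows N j) (Fin M) ℂ :=
  Matrix.of fun a m => H a.2 j a.1 m

/-- The block diagonal matrix of the `U i` for `i ≠ j`. -/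
def blockFilter (U : Fin K → Matrix (Fin N) (Fin d) ℂ) (j : Fin K) :
    Matrix (CrossRows N j) (CrossRows d j) ℂ :=
  Matrix.blockDiagonal fun i : {i : Fin K // i ≠ j} => U i

/-- `(U, V)` are interference alignment filters and precoders for the channel `H`. -/
def IsIASolution (H : Channel K N M) (U : Fin K → Matrix (Fin N) (Fin d) ℂ)
    (V : Fin K → Matrix (Fin M) (Fin d) ℂ) : Prop :=
  (∀ i j, j ≠ i → (U i)ᴴ * H.mat i j * V j = 0) ∧
    ∀ i, ((U i)ᴴ * H.mat i i * V i).rank = d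

/-- Interference alignment is feasible: generic channels admit a solution. -/
def IAFeasible (K N M d : ℕ) : Prop :=
  ∀ᵐ H : Channel K N M, ∃ (U : Fin K → Matrix (Fin N) (Fin d) ℂ)
    (V : Fin K → Matrix (Fin M) (Fin d) ℂ), IsIASolution H U V

/-- Covariance (up to the factor `P / d`) of the desired signal of user `i` after filtering. -/
def signalCov (H : Channel K N M) (U : Fin K → Matrix (Fin N) (Fin d) ℂ)
    (V : Fin K → Matrix (Fin M) (Fin d) ℂ) (i : Fin K) : Matrix (Fin d) (Fin d) ℂ :=
  (U i)ᴴ * H.mat i i * V i * (V i)ᴴ * (H.mat i i)ᴴ * U i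

/-- Covariance (up to the factor `P / d`) of the interference at user `i` after filtering. -/
def interferenceCov (H : Channel K N M) (U : Fin K → Matrix (Fin N) (Fin d) ℂ)
    (V : Fin K → Matrix (Fin M) (Fin d) ℂ) (i : Fin K) : Matrix (Fin d) (Fin d) ℂ :=
  ∑ j ∈ Finset.univ.erase i,
    (U i)ᴴ * H.mat i j * V j * (V j)ᴴ * (H.mat i j)ᴴ * U i

/-- The interference leakage power at user `i`. -/
def leakage (H : Channel K N M) (U : Fin K → Matrix (Fin N) (Fin d) ℂ)
    (V : Fin K → Matrix (Fin M) (Fin d) ℂ) (P : ℝ) (i : Fin K) : ℝ :=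
  (Matrix.trace (((P / d : ℝ) : ℂ) • interferenceCov H U V i)).re

/-- The achievable rate of user `i` in bits per channel use (Gaussian signalling, unit variance
noise, interference treated as noise). -/
def rate (H : Channel K N M) (U : Fin K → Matrix (Fin N) (Fin d) ℂ)
    (V : Fin K → Matrix (Fin M) (Fin d) ℂ) (P : ℝ) (i : Fin K) : ℝ :=
  Real.logb 2
      (1 + ((P / d : ℝ) : ℂ) • (signalCov H U V i + interferenceCov H U V i)).det.re -
    Real.logb 2 (1 + ((P / d : ℝ) : ℂ) • interferenceCov H U V i).det.re

/-- The rate `R`, as a function of the transmit power, has `x` degrees of freedom. -/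
def HasDoF (R : ℝ → ℝ) (x : ℝ) : Prop :=
  Tendsto (fun P => R P / Real.logb 2 P) atTop (𝓝 x)

/-! ### The quantization scheme -/

/-- Bits used by each base station at power `P`: `(G_b / 2) log₂ P`, rounded down. -/
def bitsBS (K N M : ℕ) (P : ℝ) : ℕ :=
  ⌊(grassmannDim ((K - 1) * N) M : ℝ) / 2 * Real.logb 2 P⌋₊

/-- Bits used by the central node per precoder at power `P`: `(G_c / 2) log₂ P`, rounded down. -/
def bitsCentral (M d : ℕ) (P : ℝ) : ℕ :=
  ⌊(grassmannDim M d : ℝ) / 2 * Real.logb 2 P⌋₊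

/-- The data of the scheme that do not depend on the channel: quantizers of the base stations and of
the central node, and the rule by which the central node solves the alignment problem for the
reconstructed stacked channels (it has no other knowledge of the channel). -/
structure Scheme (K N M d : ℕ) where
  bsQuant : (j : Fin K) → Quantizer (CrossRows N j) M
  cnQuant : Fin K → Quantizer (Fin M) d
  filters : ((j : Fin K) → Matrix (CrossRows N j) (Fin M) ℂ) → Fin K → Matrix (Fin N) (Fin d) ℂ
  precoders : ((j : Fin K) → Matrix (CrossRows N j) (Fin M) ℂ) → Fin K → Matrix (Fin M) (Fin d) ℂ
  filters_unitary : ∀ G, (∀ j, TruncatedUnitary (G j)) → ∀ i, TruncatedUnitary (filters G i)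
  precoders_unitary : ∀ G, (∀ j, TruncatedUnitary (G j)) → ∀ j, TruncatedUnitary (precoders G j)
  aligned : ∀ G, (∀ j, TruncatedUnitary (G j)) →
    ∀ j, (blockFilter (filters G) j)ᴴ * G j * precoders G j = 0

/-- All codebooks of the scheme have the largest possible minimum distance. -/
def Scheme.Optimal (σ : Scheme K N M d) : Prop :=
  (∀ j n, IsMaxMinOptimal ((σ.bsQuant j).code n)) ∧
    ∀ j n, IsMaxMinOptimal ((σ.cnQuant j).code n)

/-- The codewords the base stations send, for orthonormal bases `F j` of the column spaces of the
stacked channels. -/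
def Scheme.Fhat (σ : Scheme K N M d) (F : (j : Fin K) → Matrix (CrossRows N j) (Fin M) ℂ)
    (P : ℝ) (j : Fin K) : Matrix (CrossRows N j) (Fin M) ℂ :=
  (σ.bsQuant j).quantize (bitsBS K N M P) (F j)

/-- The receive filters, computed by the central node. -/
def Scheme.U (σ : Scheme K N M d) (F : (j : Fin K) → Matrix (CrossRows N j) (Fin M) ℂ)
    (P : ℝ) : Fin K → Matrix (Fin N) (Fin d) ℂ :=
  σ.filters (σ.Fhat F P)

/-- The quantized precoders that the central node sends. -/
def Scheme.Vhat (σ : Scheme K N M d) (F : (j : Fin K) → Matrix (CrossRows N j) (Fin M) ℂ)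
    (P : ℝ) (j : Fin K) : Matrix (Fin M) (Fin d) ℂ :=
  (σ.cnQuant j).quantize (bitsCentral M d P) (σ.precoders (σ.Fhat F P) j)

/-- The total precoders `C⁻¹ Fᴴ F̂ V̂` used by the base stations, where the stacked channels factor
as `F j * C j`. -/
def Scheme.V (σ : Scheme K N M d) (F : (j : Fin K) → Matrix (CrossRows N j) (Fin M) ℂ)
    (C : Fin K → Matrix (Fin M) (Fin M) ℂ) (P : ℝ) (j : Fin K) : Matrix (Fin M) (Fin d) ℂ :=
  (C j)⁻¹ * (F j)ᴴ * σ.Fhat F P j * σ.Vhat F P j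

end CSITSharing

end

open MeasureTheory Filter Topology
open scoped Matrix

noncomputable section

namespace CSITSharing

/-! ### Frobenius norm -/

section Frobenius

variable {l r s t : Type*} [Fintype l] [Fintype r] [Fintype s] [Fintype t]

section
attribute [local instance] Matrix.frobeniusNormedAddCommGroup

/-! Leakage. Since `H_j V_j = F F^H F̂ V̂`, the matrix `C_j` cancels, and exact alignment of `F̂`
with the unquantized precoder `Ṽ` leaves only terms proportional to the two chordal quantization
errors (`Scheme.frob_interference_le`). In a packing the covering radius is at most every pairwise
distance, and a pigeonhole over charts of the Grassmannian, a space of real dimension `D`, produces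
a close pair of codewords. With `(D / 2) log₂ P` bits the error is therefore `O(P^(-1/2))`
(`exists_quantize_error_bound`), and the leakage stays bounded.

Rate. The log-determinants are squeezed using the leakage, an upper bound on the direct gain and a
lower bound `g P` on its squared determinant; it suffices that `log (g P) = o(log P)`
(`rate_bounds`, `hasDoF_of_bounds`). The difficulty is this lower bound: the alignment rule is
arbitrary, so filters and precoders may jump as `P` grows and need not converge. They depend on the
cross links only, however, and on `P` only through the two bit counts `n`, `m`. With the cross links
fixed, the direct links in a ball whose determinant is below `tolerance n m ^ d / 2` have measure at
most a constant times `tolerance n m` for large `n`, because the determinant is a polynomial of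
degree `d` along a suitable direction (`volume_det_lt_inter_ball_le`). The tolerance is summable
over `(n, m)`, so Borel–Cantelli excludes small determinants for all large `n`
(`Scheme.ae_link_eventually_notMem_degenerate`). The tolerance decays only polynomially in the bit
counts, hence like a power of `1 / log P`, at no cost in degrees of freedom.

Existence. Generic feasibility extends to alignment for every channel by density and compactness
(`IAFeasible.exists_aligned`); optimal codebooks come from maximizing the minimum distance and then
minimizing the number of closest pairs (`exists_optimal_packing`). With perfect CSI the leakage is
zero and the gain constant. -/

theorem frob_eq_norm (A : Matrix r s ℂ) : frob A = ‖A‖ := by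
  rw [Matrix.frobenius_norm_def, frob, Real.sqrt_eq_rpow]
  simp

theorem frob_add_le (A B : Matrix r s ℂ) : frob (A + B) ≤ frob A + frob B := by
  simpa only [frob_eq_norm] using norm_add_le A B

theorem frob_sub_le (A B : Matrix r s ℂ) : frob (A - B) ≤ frob A + frob B := by
  simpa only [frob_eq_norm] using norm_sub_le A B

theorem frob_sub_rev (A B : Matrix r s ℂ) : frob (A - B) = frob (B - A) := by
  simpa only [frob_eq_norm] using norm_sub_rev A B

theorem frob_eq_zero {A : Matrix r s ℂ} : frob A = 0 ↔ A = 0 := by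
  rw [frob_eq_norm]; exact norm_eq_zero

theorem frob_conjTranspose (A : Matrix r s ℂ) : frob Aᴴ = frob A := by
  simpa only [frob_eq_norm] using Matrix.frobenius_norm_conjTranspose A

theorem frob_mul_le (A : Matrix l r ℂ) (B : Matrix r s ℂ) : frob (A * B) ≤ frob A * frob B := by
  simpa only [frob_eq_norm] using Matrix.frobenius_norm_mul A B

end

theorem frob_nonneg (A : Matrix r s ℂ) : 0 ≤ frob A := Real.sqrt_nonneg _

theorem frob_sq (A : Matrix r s ℂ) : frob A ^ 2 = ∑ a, ∑ b, ‖A a b‖ ^ 2 :=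
  Real.sq_sqrt (by positivity)

theorem frob_mul₃_le (A : Matrix l r ℂ) (B : Matrix r s ℂ) (C : Matrix s t ℂ) :
    frob (A * B * C) ≤ frob A * frob B * frob C :=
  (frob_mul_le _ _).trans (mul_le_mul_of_nonneg_right (frob_mul_le _ _) (frob_nonneg _))

theorem trace_mul_conjTranspose_self (A : Matrix r s ℂ) :
    Matrix.trace (A * Aᴴ) = ((frob A ^ 2 : ℝ) : ℂ) := by
  rw [frob_sq]
  simp only [Matrix.trace, Matrix.diag, Matrix.mul_apply, Matrix.conjTranspose_apply]
  push_cast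
  refine Finset.sum_congr rfl fun a _ => Finset.sum_congr rfl fun b _ => ?_
  rw [Complex.star_def, Complex.mul_conj, Complex.normSq_eq_norm_sq]
  push_cast; rfl

theorem norm_apply_le_frob (A : Matrix r s ℂ) (a : r) (b : s) : ‖A a b‖ ≤ frob A := by
  refine Real.le_sqrt_of_sq_le ?_
  calc ‖A a b‖ ^ 2 ≤ ∑ b, ‖A a b‖ ^ 2 :=
        Finset.single_le_sum (f := fun b => ‖A a b‖ ^ 2) (fun _ _ => by positivity)
          (Finset.mem_univ b)
    _ ≤ _ := Finset.single_le_sum (f := fun a => ∑ b, ‖A a b‖ ^ 2) (fun _ _ => by positivity)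
          (Finset.mem_univ a)

theorem frob_le_of_norm_le {A : Matrix r s ℂ} {c : ℝ} (hc : 0 ≤ c) (h : ∀ a b, ‖A a b‖ ≤ c) :
    frob A ≤ (Fintype.card r * Fintype.card s) * c := by
  have h1 : ∑ a, ∑ b, ‖A a b‖ ^ 2 ≤ (Fintype.card r * Fintype.card s) * c ^ 2 := by
    calc ∑ a, ∑ b, ‖A a b‖ ^ 2 ≤ ∑ _a : r, ∑ _b : s, c ^ 2 := by
          gcongr with a _ b _; exact h a b
      _ = _ := by simp [mul_assoc]
  rw [frob]
  refine Real.sqrt_le_iff.2 ⟨by positivity, h1.trans ?_⟩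
  rw [mul_pow]
  refine mul_le_mul_of_nonneg_right ?_ (by positivity)
  have : (Fintype.card r * Fintype.card s : ℝ) = ((Fintype.card r * Fintype.card s : ℕ) : ℝ) := by
    push_cast; rfl
  rw [this]
  -- The number of entries is a natural number, hence at most its square; this avoids a square root
  -- in the bound.
  exact_mod_cast Nat.le_self_pow two_ne_zero _

theorem frob_submatrix_le {f : l → r} (hf : Function.Injective f) (A : Matrix r s ℂ) :
    frob (A.submatrix f id) ≤ frob A := by
  refine Real.sqrt_le_sqrt ?_
  simp only [Matrix.submatrix_apply, id]
  classical
  rw [← Finset.sum_image (f := fun a => ∑ b, ‖A a b‖ ^ 2) (s := Finset.univ) (g := f)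
    (fun a _ b _ h => hf h)]
  exact Finset.sum_le_sum_of_subset_of_nonneg (Finset.subset_univ _) fun _ _ _ => by positivity

theorem continuous_frob : Continuous (frob : Matrix r s ℂ → ℝ) := by
  unfold frob
  refine Real.continuous_sqrt.comp (continuous_finsetSum _ fun a _ => continuous_finsetSum _
    fun b _ => (continuous_norm.comp ?_).pow 2)
  exact (continuous_apply b).comp (continuous_apply a)

end Frobenius

/-! ### Truncated unitary matrices -/

section TruncatedUnitary

variable {r : Type*} [Fintype r] {p : ℕ} {X Y : Matrix r (Fin p) ℂ}

theorem TruncatedUnitary.frob_sq_eq (hX : TruncatedUnitary X) : frob X ^ 2 = p := by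
  have h := trace_mul_conjTranspose_self X
  rw [Matrix.trace_mul_comm, hX, Matrix.trace_one, Fintype.card_fin] at h
  exact_mod_cast h.symm

theorem TruncatedUnitary.frob_eq (hX : TruncatedUnitary X) : frob X = Real.sqrt p := by
  rw [← hX.frob_sq_eq, Real.sqrt_sq (frob_nonneg _)]

theorem TruncatedUnitary.frob_proj_mul_le (hX : TruncatedUnitary X) {s : Type*} [Fintype s]
    (A : Matrix r s ℂ) : frob (X * Xᴴ * A) ≤ p * frob A := by
  refine (frob_mul₃_le _ _ _).trans (le_of_eq ?_)
  rw [frob_conjTranspose, ← sq, hX.frob_sq_eq]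

theorem chordalDist_nonneg (X Y : Matrix r (Fin p) ℂ) : 0 ≤ chordalDist X Y :=
  mul_nonneg (by positivity) (frob_nonneg _)

theorem chordalDist_comm (X Y : Matrix r (Fin p) ℂ) : chordalDist X Y = chordalDist Y X := by
  rw [chordalDist, frob_sub_rev, chordalDist]

theorem chordalDist_sq (X Y : Matrix r (Fin p) ℂ) :
    chordalDist X Y ^ 2 = frob (X * Xᴴ - Y * Yᴴ) ^ 2 / 2 := by
  rw [chordalDist, mul_pow, div_pow, Real.sq_sqrt (by norm_num)]; ring

theorem frob_sub_eq_chordalDist (X Y : Matrix r (Fin p) ℂ) :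
    frob (X * Xᴴ - Y * Yᴴ) = Real.sqrt 2 * chordalDist X Y := by
  rw [chordalDist, ← mul_assoc, mul_one_div_cancel (by positivity), one_mul]

theorem chordalDist_eq_zero : chordalDist X Y = 0 ↔ X * Xᴴ = Y * Yᴴ := by
  rw [chordalDist, mul_eq_zero, frob_eq_zero, sub_eq_zero]
  simp

theorem TruncatedUnitary.chordalDist_sq_eq_trace (hX : TruncatedUnitary X)
    (hY : TruncatedUnitary Y) :
    chordalDist X Y ^ 2 = p - (Matrix.trace (X * Xᴴ * (Y * Yᴴ))).re := by
  have key := trace_mul_conjTranspose_self (X * Xᴴ - Y * Yᴴ)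
  have hXX : X * Xᴴ * (X * Xᴴ) = X * Xᴴ := by
    rw [Matrix.mul_assoc, ← Matrix.mul_assoc Xᴴ, show Xᴴ * X = 1 from hX, Matrix.one_mul]
  have hYY : Y * Yᴴ * (Y * Yᴴ) = Y * Yᴴ := by
    rw [Matrix.mul_assoc, ← Matrix.mul_assoc Yᴴ, show Yᴴ * Y = 1 from hY, Matrix.one_mul]
  have htX : Matrix.trace (X * Xᴴ) = p := by
    rw [Matrix.trace_mul_comm, show Xᴴ * X = 1 from hX, Matrix.trace_one, Fintype.card_fin]
  have htY : Matrix.trace (Y * Yᴴ) = p := by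
    rw [Matrix.trace_mul_comm, show Yᴴ * Y = 1 from hY, Matrix.trace_one, Fintype.card_fin]
  rw [Matrix.conjTranspose_sub, Matrix.conjTranspose_mul, Matrix.conjTranspose_mul,
    Matrix.conjTranspose_conjTranspose, Matrix.conjTranspose_conjTranspose, Matrix.sub_mul,
    Matrix.mul_sub, Matrix.mul_sub, hXX, hYY, Matrix.trace_sub, Matrix.trace_sub,
    Matrix.trace_sub, htX, htY, Matrix.trace_mul_comm (Y * Yᴴ)] at key
  have := congrArg Complex.re key
  simp only [Complex.sub_re, Complex.ofReal_re, Complex.natCast_re] at this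
  rw [chordalDist_sq, ← this]; ring

/-- Both sides equal `p - tr(X Xᴴ Y Yᴴ)`. The asymmetric form is the residual of projecting `X` onto
the span of `Y`, which is easy to estimate. -/
theorem TruncatedUnitary.chordalDist_sq_eq (hX : TruncatedUnitary X) (hY : TruncatedUnitary Y) :
    chordalDist X Y ^ 2 = frob (X - Y * Yᴴ * X) ^ 2 := by
  have key := trace_mul_conjTranspose_self (X - Y * Yᴴ * X)
  have htX : Matrix.trace (X * Xᴴ) = p := by
    rw [Matrix.trace_mul_comm, show Xᴴ * X = 1 from hX, Matrix.trace_one, Fintype.card_fin]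
  have h4 : Y * Yᴴ * X * (Xᴴ * (Y * Yᴴ)) = Y * (Yᴴ * (X * Xᴴ) * Y * Yᴴ) := by
    simp only [Matrix.mul_assoc]
  have h5 : Matrix.trace (Y * (Yᴴ * (X * Xᴴ) * Y * Yᴴ)) =
      Matrix.trace (X * Xᴴ * (Y * Yᴴ)) := by
    rw [Matrix.trace_mul_comm, Matrix.mul_assoc, show Yᴴ * Y = 1 from hY, Matrix.mul_one,
      Matrix.mul_assoc, Matrix.trace_mul_comm, Matrix.mul_assoc]
  rw [Matrix.conjTranspose_sub, Matrix.conjTranspose_mul, Matrix.conjTranspose_mul,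
    Matrix.conjTranspose_conjTranspose, Matrix.sub_mul,
    Matrix.mul_sub, Matrix.mul_sub, h4, Matrix.trace_sub, Matrix.trace_sub,
    Matrix.trace_sub, h5, htX, Matrix.mul_assoc (Y * Yᴴ) X Xᴴ, Matrix.trace_mul_comm (Y * Yᴴ),
    ← Matrix.mul_assoc X Xᴴ] at key
  have := congrArg Complex.re key
  simp only [Complex.sub_re, Complex.ofReal_re, Complex.natCast_re] at this
  rw [hX.chordalDist_sq_eq_trace hY, ← this]; ring

/-- A crude diameter bound, used for small `P` and as covering radius of a one-word codebook. -/
theorem TruncatedUnitary.chordalDist_le (hX : TruncatedUnitary X) (hY : TruncatedUnitary Y) :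
    chordalDist X Y ≤ (1 + p) * Real.sqrt p := by
  have h : chordalDist X Y = frob (X - Y * Yᴴ * X) :=
    (sq_eq_sq₀ (chordalDist_nonneg _ _) (frob_nonneg _)).1 (hX.chordalDist_sq_eq hY)
  rw [h]
  refine (frob_sub_le _ _).trans ?_
  have := hY.frob_proj_mul_le X
  rw [hX.frob_eq] at *
  linarith

/-- Two subspaces with bases that are close to each other are close. -/
theorem TruncatedUnitary.chordalDist_le_of_basis (hX : TruncatedUnitary X)
    (hY : TruncatedUnitary Y) {X' Y' : Matrix r (Fin p) ℂ} {S T : Matrix (Fin p) (Fin p) ℂ}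
    (hS : X = X' * S) (hT : Y' = Y * T) :
    chordalDist X Y ≤ (1 + p) * frob (X' - Y') * frob S := by
  have h : chordalDist X Y = frob (X - Y * Yᴴ * X) :=
    (sq_eq_sq₀ (chordalDist_nonneg _ _) (frob_nonneg _)).1 (hX.chordalDist_sq_eq hY)
  have hY' : Y * Yᴴ * Y' = Y' := by
    rw [hT, Matrix.mul_assoc, ← Matrix.mul_assoc Yᴴ, show Yᴴ * Y = 1 from hY, Matrix.one_mul]
  -- The complementary projection kills `Y'`, so only the difference `X' - Y'` contributes.
  have h2 : X - Y * Yᴴ * X = ((X' - Y') - Y * Yᴴ * (X' - Y')) * S := by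
    rw [Matrix.mul_sub (Y * Yᴴ), hY', hS, Matrix.sub_mul, Matrix.sub_mul, Matrix.sub_mul,
      ← Matrix.mul_assoc]
    abel
  rw [h, h2]
  refine (frob_mul_le _ _).trans (mul_le_mul_of_nonneg_right ?_ (frob_nonneg _))
  refine (frob_sub_le _ _).trans ?_
  have := hY.frob_proj_mul_le (X' - Y')
  linarith

theorem TruncatedUnitary.norm_apply_le (hX : TruncatedUnitary X) (a : r) (b : Fin p) :
    ‖X a b‖ ≤ 1 := by
  have h : (Xᴴ * X) b b = 1 := by rw [show Xᴴ * X = 1 from hX, Matrix.one_apply_eq]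
  have h2 : ∑ a, ‖X a b‖ ^ 2 = 1 := by
    have h3 : ((∑ a, ‖X a b‖ ^ 2 : ℝ) : ℂ) = 1 := by
      rw [← h, Matrix.mul_apply]
      push_cast
      refine Finset.sum_congr rfl fun c _ => ?_
      rw [Matrix.conjTranspose_apply, Complex.star_def, mul_comm, Complex.mul_conj,
        Complex.normSq_eq_norm_sq]
      push_cast; rfl
    exact_mod_cast h3
  have h4 : ‖X a b‖ ^ 2 ≤ 1 := h2 ▸ Finset.single_le_sum (f := fun a => ‖X a b‖ ^ 2)
    (fun _ _ => by positivity) (Finset.mem_univ a)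
  exact (sq_le_one_iff₀ (norm_nonneg _)).1 h4

theorem isClosed_truncatedUnitary : IsClosed {X : Matrix r (Fin p) ℂ | TruncatedUnitary X} := by
  have : Continuous fun X : Matrix r (Fin p) ℂ => Xᴴ * X := by fun_prop
  exact isClosed_eq this continuous_const

theorem isCompact_truncatedUnitary : IsCompact {X : Matrix r (Fin p) ℂ | TruncatedUnitary X} := by
  have h : IsCompact (Set.pi Set.univ fun _ : r => Set.pi Set.univ fun _ : Fin p =>
      Metric.closedBall (0 : ℂ) 1) :=
    isCompact_univ_pi fun _ => isCompact_univ_pi fun _ => isCompact_closedBall _ _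
  refine h.of_isClosed_subset isClosed_truncatedUnitary ?_
  intro X hX a _ b _
  simpa using TruncatedUnitary.norm_apply_le hX a b

theorem continuous_chordalDist :
    Continuous fun z : Matrix r (Fin p) ℂ × Matrix r (Fin p) ℂ => chordalDist z.1 z.2 := by
  unfold chordalDist
  exact continuous_const.mul (continuous_frob.comp (by fun_prop))

open scoped ComplexOrder MatrixOrder in
/-- A matrix of full column rank factors into a truncated unitary and an invertible matrix. -/
theorem exists_truncatedUnitary_mul {X : Matrix r (Fin p) ℂ} (hX : (Xᴴ * X).det ≠ 0) :
    ∃ (F : Matrix r (Fin p) ℂ) (C : Matrix (Fin p) (Fin p) ℂ),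
      TruncatedUnitary F ∧ C.det ≠ 0 ∧ X = F * C := by
  -- `B` satisfies `Bᴴ B = Xᴴ X`; normalizing by its inverse makes the columns orthonormal.
  obtain ⟨B, hB⟩ := CStarAlgebra.nonneg_iff_eq_star_mul_self.mp
    (Matrix.posSemidef_conjTranspose_mul_self X).nonneg
  have hBd : B.det ≠ 0 := by
    intro h
    rw [hB, Matrix.det_mul, h, mul_zero] at hX
    exact hX rfl
  have hBu : IsUnit B.det := isUnit_iff_ne_zero.2 hBd
  refine ⟨X * B⁻¹, B, ?_, hBd, ?_⟩
  · rw [TruncatedUnitary, Matrix.conjTranspose_mul, Matrix.mul_assoc, ← Matrix.mul_assoc Xᴴ, hB,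
      Matrix.star_eq_conjTranspose, Matrix.mul_assoc, Matrix.mul_nonsing_inv _ hBu,
      Matrix.mul_one, ← Matrix.conjTranspose_mul, Matrix.mul_nonsing_inv _ hBu,
      Matrix.conjTranspose_one]
  · rw [Matrix.mul_assoc, Matrix.nonsing_inv_mul _ hBu, Matrix.mul_one]

open scoped ComplexOrder in
theorem det_conjTranspose_mul_self_ne_zero {X : Matrix r (Fin p) ℂ} (h : X.rank = p) :
    (Xᴴ * X).det ≠ 0 := by
  intro h0
  have h1 : (Xᴴ * X).rank = p := by rw [Matrix.rank_conjTranspose_mul_self, h]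
  obtain ⟨v, hv, hv2⟩ := Matrix.exists_mulVec_eq_zero_iff.2 h0
  have : LinearIndependent ℂ (Xᴴ * X).col := by
    rw [linearIndependent_iff_card_eq_finrank_span, Fintype.card_fin, Set.finrank,
      ← Matrix.rank_eq_finrank_span_cols, h1]
  have h3 := Matrix.mulVec_injective_iff.2 this
  exact hv (h3 (by rw [hv2, Matrix.mulVec_zero]))

end TruncatedUnitary

/-! ### Quantization error of subspace packings -/

section Covering

variable {r : Type*} [Fintype r] {p : ℕ}

/-- A Cauchy–Binet argument: multilinearity expands `det (Xᴴ X) = 1` over choices of `p` rows of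
`X`, so some minor is nonzero. -/
theorem TruncatedUnitary.exists_submatrix_det_ne_zero {X : Matrix r (Fin p) ℂ}
    (hX : TruncatedUnitary X) : ∃ S : Fin p → r, (X.submatrix S id).det ≠ 0 := by
  by_contra! h
  have h1 : (Xᴴ * X).det = 1 := by rw [show Xᴴ * X = 1 from hX, Matrix.det_one]
  have h2 : (Xᴴ * X).det = ∑ S : Fin p → r, (∏ i, Xᴴ i (S i)) * (X.submatrix S id).det := by
    have : Xᴴ * X = fun i => ∑ a, Xᴴ i a • X a := by
      ext i j; simp [Matrix.mul_apply, Finset.sum_apply]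
    rw [this]
    refine (MultilinearMap.map_sum (Matrix.detRowAlternating (R := ℂ)).toMultilinearMap
      fun i a => Xᴴ i a • X a).trans ?_
    refine Finset.sum_congr rfl fun S _ => ?_
    rw [MultilinearMap.map_smul_univ]
    rfl
  rw [h1] at h2
  simp [h] at h2

/-- Every subspace has a basis with bounded entries, that contains an identity matrix. -/
theorem TruncatedUnitary.exists_bounded_basis {X : Matrix r (Fin p) ℂ}
    (hX : TruncatedUnitary X) :
    ∃ (S : Fin p → r) (Y : Matrix r (Fin p) ℂ), Function.Injective S ∧
      (∀ a b, ‖Y a b‖ ≤ 1) ∧ Y.submatrix S id = 1 ∧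
      X = Y * X.submatrix S id ∧ Y = X * (X.submatrix S id)⁻¹ := by
  obtain ⟨S₀, hS₀⟩ := hX.exists_submatrix_det_ne_zero
  have : Nonempty (Fin p → r) := ⟨S₀⟩
  -- For a minor of largest modulus, Cramer's rule writes each entry of `X * X_S⁻¹` as a minor
  -- divided by this one, hence of modulus at most 1.
  obtain ⟨S, hS⟩ := Finite.exists_max fun S : Fin p → r => ‖(X.submatrix S id).det‖
  have hdet : (X.submatrix S id).det ≠ 0 := by
    intro h
    have := hS S₀
    rw [h, norm_zero] at this
    exact hS₀ (norm_le_zero_iff.1 this)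
  have hu : IsUnit (X.submatrix S id).det := isUnit_iff_ne_zero.2 hdet
  refine ⟨S, X * (X.submatrix S id)⁻¹, ?_, ?_, ?_, ?_, rfl⟩
  · intro a b hab
    by_contra hne
    exact hdet (Matrix.det_zero_of_row_eq hne (by ext j; simp [hab]))
  · intro a b
    have h1 : (X * (X.submatrix S id)⁻¹) a b =
        (X.submatrix S id).det⁻¹ * (X.submatrix (Function.update S b a) id).det := by
      have h2 : X.submatrix (Function.update S b a) id =
          (X.submatrix S id).updateRow b (X a) := by
        ext i j
        by_cases hi : i = b
        · subst hi; simp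
        · simp [hi]
      rw [h2, ← Matrix.cramer_transpose_apply, Matrix.cramer_eq_adjugate_mulVec,
        ← Matrix.adjugate_transpose, Matrix.inv_def, Ring.inverse_eq_inv', Matrix.mul_apply]
      simp only [Matrix.mulVec, dotProduct, Matrix.smul_apply, smul_eq_mul,
        Matrix.transpose_apply, Finset.mul_sum]
      refine Finset.sum_congr rfl fun c _ => by ring
    rw [h1, norm_mul, norm_inv]
    exact inv_mul_le_one_of_le₀ (hS _) (norm_nonneg _)
  · rw [show (X * (X.submatrix S id)⁻¹).submatrix S id =
      X.submatrix S id * (X.submatrix S id)⁻¹ from rfl, Matrix.mul_nonsing_inv _ hu]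
  · rw [Matrix.mul_assoc, Matrix.nonsing_inv_mul _ hu, Matrix.mul_one]

theorem abs_sub_le_of_floor_mul_eq {k : ℕ} (hk : 0 < k) {x y : ℝ}
    (h : ⌊k * x⌋ = ⌊k * y⌋) : |x - y| ≤ 1 / k := by
  have h1 := Int.abs_sub_lt_one_of_floor_eq_floor h
  rw [← mul_sub, abs_mul, Nat.abs_cast] at h1
  rw [le_div_iff₀ (by positivity), mul_comm]
  exact h1.le

theorem floor_mul_mem_Icc {k : ℕ} {x : ℝ} (h : |x| ≤ 1) :
    ⌊k * x⌋ ∈ Finset.Icc (-(k : ℤ)) k := by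
  obtain ⟨h1, h2⟩ := abs_le.1 h
  rw [Finset.mem_Icc]
  constructor
  · rw [Int.le_floor]; push_cast; nlinarith [(Nat.cast_nonneg k : (0 : ℝ) ≤ k)]
  · have : (⌊k * x⌋ : ℝ) ≤ k := (Int.floor_le _).trans
      (by nlinarith [(Nat.cast_nonneg k : (0 : ℝ) ≤ k)])
    exact_mod_cast this

/-- The Grassmann manifold is covered by boundedly many charts, each of which is cut into cells of
small diameter; the label of a subspace is the index of a chart and a cell. -/
abbrev GridLabel (r : Type*) (p k : ℕ) : Type _ :=
  Σ S : {S : Fin p → r // Function.Injective S},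
    {a : r // a ∉ Set.range S.1} × Fin p → Finset.Icc (-(k : ℤ)) k × Finset.Icc (-(k : ℤ)) k

open Classical in
-- The rows in `S` form an identity block, leaving `(card r - p) * p` free complex entries; their
-- real and imaginary parts give the exponent `grassmannDim`.
theorem card_gridLabel_le (r : Type*) [Fintype r] (p k : ℕ) :
    Fintype.card (GridLabel r p k) ≤
      Fintype.card (Fin p → r) * (2 * k + 1) ^ grassmannDim (Fintype.card r) p := by
  rw [Fintype.card_sigma]
  have hI : Fintype.card (Finset.Icc (-(k : ℤ)) k) = 2 * k + 1 := by
    rw [Fintype.card_coe, Int.card_Icc]; omega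
  have h : ∀ S : {S : Fin p → r // Function.Injective S},
      Fintype.card ({a : r // a ∉ Set.range S.1} × Fin p →
        Finset.Icc (-(k : ℤ)) k × Finset.Icc (-(k : ℤ)) k) =
      (2 * k + 1) ^ grassmannDim (Fintype.card r) p := by
    intro S
    have : Fintype.card {a : r // a ∉ Set.range S.1} = Fintype.card r - p := by
      rw [Fintype.card_subtype_compl]
      congr 1
      exact (Set.card_range_of_injective S.2).trans (Fintype.card_fin p)
    rw [Fintype.card_fun, Fintype.card_prod, Fintype.card_prod, hI, this, Fintype.card_fin, ← sq,
      ← pow_mul, grassmannDim]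
    congr 1; ring
  rw [Finset.sum_congr rfl fun S _ => h S, Finset.sum_const, smul_eq_mul, Finset.card_univ]
  exact Nat.mul_le_mul_right _ (Fintype.card_subtype_le _)

/-- Among sufficiently many subspaces there are two that are close to each other. -/
theorem exists_chordalDist_le_of_card_lt {m k : ℕ} (hk : 0 < k)
    (code : Fin m → Matrix r (Fin p) ℂ) (hcode : ∀ a, TruncatedUnitary (code a))
    (hm : Fintype.card (Fin p → r) * (2 * k + 1) ^ grassmannDim (Fintype.card r) p < m) :
    ∃ a b, a ≠ b ∧ chordalDist (code a) (code b) ≤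
      (1 + p) * (Fintype.card r * p * 2) * Real.sqrt p / k := by
  classical
  choose S Y hS hY1 hYS hX hYX using fun a => (hcode a).exists_bounded_basis
  let label : Fin m → GridLabel r p k := fun a =>
    ⟨⟨S a, hS a⟩, fun x =>
      (⟨⌊k * (Y a x.1 x.2).re⌋, floor_mul_mem_Icc ((Complex.abs_re_le_norm _).trans (hY1 _ _ _))⟩,
        ⟨⌊k * (Y a x.1 x.2).im⌋,
          floor_mul_mem_Icc ((Complex.abs_im_le_norm _).trans (hY1 _ _ _))⟩)⟩
  obtain ⟨a, b, hab, hl⟩ := Fintype.exists_ne_map_eq_of_card_lt label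
    (by rw [Fintype.card_fin]; exact (card_gridLabel_le r p k).trans_lt hm)
  refine ⟨a, b, hab, ?_⟩
  have hSab : S a = S b := congrArg (fun z : GridLabel r p k => z.1.1) hl
  -- Labels are dependent pairs over the chart; this compares their entries without casts along the
  -- equality of charts.
  have hcell : ∀ (z w : GridLabel r p k), z = w → ∀ (x : r) (h : x ∉ Set.range z.1.1)
      (h' : x ∉ Set.range w.1.1) (c : Fin p), z.2 (⟨x, h⟩, c) = w.2 (⟨x, h'⟩, c) := by
    rintro z w rfl x h h' c; rfl
  have hent : ∀ x c, ‖(Y a - Y b) x c‖ ≤ 2 / k := by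
    intro x c
    by_cases hx : x ∈ Set.range (S a)
    · obtain ⟨i, rfl⟩ := hx
      have h1 : Y a (S a i) c = (1 : Matrix (Fin p) (Fin p) ℂ) i c := by rw [← hYS a]; rfl
      have h2 : Y b (S a i) c = (1 : Matrix (Fin p) (Fin p) ℂ) i c := by rw [← hYS b, hSab]; rfl
      rw [Matrix.sub_apply, h1, h2, sub_self, norm_zero]
      positivity
    · have hl' := hcell _ _ hl x hx (by show x ∉ Set.range (S b); rwa [← hSab]) c
      have hre : ⌊k * (Y a x c).re⌋ = ⌊k * (Y b x c).re⌋ :=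
        congrArg (fun z => (z.1 : ℤ)) hl'
      have him : ⌊k * (Y a x c).im⌋ = ⌊k * (Y b x c).im⌋ :=
        congrArg (fun z => (z.2 : ℤ)) hl'
      refine (Complex.norm_le_abs_re_add_abs_im _).trans ?_
      rw [Matrix.sub_apply, Complex.sub_re, Complex.sub_im]
      have := abs_sub_le_of_floor_mul_eq hk hre
      have := abs_sub_le_of_floor_mul_eq hk him
      calc _ ≤ 1 / (k : ℝ) + 1 / k := by gcongr
        _ = _ := by ring
  have h1 := (hcode a).chordalDist_le_of_basis (hcode b) (hX a) (hYX b)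
  have h2 := frob_le_of_norm_le (by positivity) hent
  have h3 : frob ((code a).submatrix (S a) id) ≤ Real.sqrt p :=
    (frob_submatrix_le (hS a) _).trans (hcode a).frob_eq.le
  rw [Fintype.card_fin] at h2
  calc _ ≤ _ := h1
    _ ≤ (1 + p) * (Fintype.card r * p * (2 / k)) * Real.sqrt p := by
        gcongr
        exact frob_nonneg _
    _ = _ := by ring

/-- The same `δ` bounds pairwise distances from below and the covering error from above, so one
close pair makes the whole codebook fine. -/
theorem IsSubspacePacking.exists_chordalDist_le {m k : ℕ} (hk : 0 < k)
    {code : Fin m → Matrix r (Fin p) ℂ} (hcode : IsSubspacePacking code)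
    (hm : Fintype.card (Fin p → r) * (2 * k + 1) ^ grassmannDim (Fintype.card r) p < m)
    {X : Matrix r (Fin p) ℂ} (hX : TruncatedUnitary X) :
    ∃ a, chordalDist (code a) X ≤ (1 + p) * (Fintype.card r * p * 2) * Real.sqrt p / k := by
  obtain ⟨hTU, δ, hδ, hcov⟩ := hcode
  obtain ⟨a, b, hab, h⟩ := exists_chordalDist_le_of_card_lt hk code hTU hm
  obtain ⟨c, hc⟩ := hcov X hX
  exact ⟨c, hc.trans ((hδ a b hab).trans h)⟩

theorem Quantizer.truncatedUnitary_quantize (q : Quantizer r p) (n : ℕ) (X : Matrix r (Fin p) ℂ) :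
    TruncatedUnitary (q.quantize n X) :=
  (q.packing n).1 _

/-- Rounding down loses less than one bit, hence the factor `1 / 2`. -/
theorem two_pow_floor_gt {D : ℕ} {P : ℝ} (hP : 1 ≤ P) :
    Real.sqrt P ^ D / 2 < 2 ^ ⌊(D : ℝ) / 2 * Real.logb 2 P⌋₊ := by
  have hP0 : 0 < P := by linarith
  have h1 : Real.sqrt P ^ D = (2 : ℝ) ^ ((D : ℝ) / 2 * Real.logb 2 P) := by
    rw [mul_comm, Real.rpow_mul (by norm_num), Real.rpow_logb (by norm_num) (by norm_num) hP0,
      Real.sqrt_eq_rpow, ← Real.rpow_natCast, ← Real.rpow_mul hP0.le]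
    congr 1; ring
  have h2 := Nat.lt_floor_add_one ((D : ℝ) / 2 * Real.logb 2 P)
  have h3 := Real.rpow_lt_rpow_of_exponent_lt (x := 2) (by norm_num) h2
  rw [← h1] at h3
  have h4 : (2 : ℝ) ^ ((⌊(D : ℝ) / 2 * Real.logb 2 P⌋₊ : ℝ) + 1) =
      2 ^ ⌊(D : ℝ) / 2 * Real.logb 2 P⌋₊ * 2 := by
    rw [Real.rpow_add (by norm_num), Real.rpow_natCast, Real.rpow_one]
  rw [h4] at h3
  linarith

/-- With `(D / 2) log₂ P` bits, where `D` is the dimension of the Grassmann manifold, the squared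
quantization error is of order `1 / P`. -/
theorem exists_quantize_error_bound (r : Type*) [Fintype r] (p : ℕ) : ∃ c : ℝ, 0 ≤ c ∧
    ∀ (q : Quantizer r p) (P : ℝ), 1 ≤ P → ∀ X : Matrix r (Fin p) ℂ, TruncatedUnitary X →
      Real.sqrt P * chordalDist (q.quantize ⌊(grassmannDim (Fintype.card r) p : ℝ) / 2 *
        Real.logb 2 P⌋₊ X) X ≤ c := by
  set D := grassmannDim (Fintype.card r) p with hD
  -- In dimension zero the Grassmannian is a single point, and any codeword is exact.
  by_cases hD0 : D = 0
  · refine ⟨0, le_rfl, fun q P hP X hX => ?_⟩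
    have hQ := q.truncatedUnitary_quantize ⌊(D : ℝ) / 2 * Real.logb 2 P⌋₊ X
    suffices h : chordalDist (q.quantize ⌊(D : ℝ) / 2 * Real.logb 2 P⌋₊ X) X = 0 by
      rw [h, mul_zero]
    rw [chordalDist_eq_zero]
    have hp : p = 0 ∨ Fintype.card r ≤ p := by
      rw [hD, grassmannDim] at hD0
      rcases Nat.mul_eq_zero.1 hD0 with h | h <;> omega
    have key : ∀ Y : Matrix r (Fin p) ℂ, TruncatedUnitary Y → Fintype.card r ≤ p →
        ∀ Z : Matrix r (Fin p) ℂ, TruncatedUnitary Z → Y * Yᴴ = Z * Zᴴ := by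
      classical
      intro Y hY hc Z hZ
      obtain ⟨S, -, hS, -⟩ := hY.exists_bounded_basis
      have hcard : Fintype.card (Fin p) = Fintype.card r :=
        le_antisymm (Fintype.card_le_of_injective S hS) (by rwa [Fintype.card_fin])
      rw [(Matrix.mul_eq_one_comm_of_equiv (Fintype.equivOfCardEq hcard).symm).2 hY,
        (Matrix.mul_eq_one_comm_of_equiv (Fintype.equivOfCardEq hcard).symm).2 hZ]
    rcases hp with h | h
    · subst h
      ext a b
      simp [Matrix.mul_apply]
    · exact key _ hQ h _ hX
  have hD1 : 1 ≤ D := Nat.one_le_iff_ne_zero.2 hD0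
  set A : ℝ := (Fintype.card (Fin p → r) : ℝ) with hA
  -- The factor 6 is 3 times 2: 3 from `2 k + 1 ≤ 3 k`, 2 from the lost bit. The factor `A + 1`
  -- absorbs the number of charts.
  set B : ℝ := 6 * (A + 1) with hB
  set L : ℝ := (1 + p) * (Fintype.card r * p * 2) * Real.sqrt p with hL
  have hA0 : 0 ≤ A := Nat.cast_nonneg _
  have hL0 : 0 ≤ L := by positivity
  have hB1 : 6 ≤ B := by linarith
  have hK0 : (0 : ℝ) ≤ (1 + p) * Real.sqrt p := by positivity
  refine ⟨B * ((1 + p) * Real.sqrt p) + 2 * B * L, by positivity, fun q P hP X hX => ?_⟩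
  have hs1 : 1 ≤ Real.sqrt P := Real.one_le_sqrt.2 hP
  have hQ := q.truncatedUnitary_quantize ⌊(D : ℝ) / 2 * Real.logb 2 P⌋₊ X
  by_cases hPB : Real.sqrt P ≤ B
  · have h1 := hQ.chordalDist_le hX
    have : Real.sqrt P * chordalDist (q.quantize ⌊(D : ℝ) / 2 * Real.logb 2 P⌋₊ X) X ≤
        B * ((1 + p) * Real.sqrt p) :=
      mul_le_mul hPB h1 (chordalDist_nonneg _ _) (by linarith)
    have : 0 ≤ 2 * B * L := by positivity
    linarith
  · push Not at hPB
    set k := ⌊Real.sqrt P / B⌋₊ with hk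
    have hx1 : 1 ≤ Real.sqrt P / B := by rw [le_div_iff₀ (by linarith)]; linarith
    have hk1 : 1 ≤ k := Nat.le_floor (by simpa using hx1)
    have hkle : (k : ℝ) ≤ Real.sqrt P / B := Nat.floor_le (by positivity)
    have hklt : Real.sqrt P / B < k + 1 := Nat.lt_floor_add_one _
    have hk1' : (1 : ℝ) ≤ k := by exact_mod_cast hk1
    have hm : Fintype.card (Fin p → r) * (2 * k + 1) ^ D < 2 ^ ⌊(D : ℝ) / 2 * Real.logb 2 P⌋₊ := by
      have h0 := two_pow_floor_gt (D := D) hP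
      have h1 : A * (2 * k + 1) ^ D ≤ Real.sqrt P ^ D / 2 := by
        have h2 : (2 * k + 1 : ℝ) ≤ Real.sqrt P * (1 / (2 * (A + 1))) := by
          calc (2 * k + 1 : ℝ) ≤ 3 * k := by linarith
            _ ≤ 3 * (Real.sqrt P / B) := by linarith
            _ = _ := by rw [hB]; field_simp; norm_num
        have h3 : (2 * k + 1 : ℝ) ^ D ≤ Real.sqrt P ^ D * (1 / (2 * (A + 1))) := by
          refine (pow_le_pow_left₀ (by positivity) h2 D).trans ?_
          rw [mul_pow]
          refine mul_le_mul_of_nonneg_left ?_ (by positivity)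
          refine pow_le_of_le_one (by positivity) ?_ hD0
          rw [div_le_one (by positivity)]; linarith
        calc A * (2 * k + 1) ^ D ≤ A * (Real.sqrt P ^ D * (1 / (2 * (A + 1)))) := by gcongr
          _ = Real.sqrt P ^ D / 2 * (A / (A + 1)) := by field_simp
          _ ≤ Real.sqrt P ^ D / 2 * 1 := by
              gcongr
              rw [div_le_one (by positivity)]; linarith
          _ = _ := mul_one _
      have h4 := h1.trans_lt h0
      rw [hA] at h4
      exact_mod_cast h4
    obtain ⟨a, ha⟩ := (q.packing _).exists_chordalDist_le hk1 hm hX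
    have h5 := (q.nearest _ X a).trans ha
    have h6 : Real.sqrt P * chordalDist (q.quantize ⌊(D : ℝ) / 2 * Real.logb 2 P⌋₊ X) X ≤
        Real.sqrt P * (L / k) := mul_le_mul_of_nonneg_left h5 (by positivity)
    have h7 : Real.sqrt P * (L / k) ≤ 2 * B * L := by
      rw [mul_div_assoc', div_le_iff₀ (by linarith)]
      -- Uses `k + 1 ≤ 2 k`, valid since `k ≥ 1`.
      have : Real.sqrt P ≤ 2 * B * k := by
        rw [div_lt_iff₀ (by linarith)] at hklt
        nlinarith
      nlinarith
    have : 0 ≤ B * ((1 + p) * Real.sqrt p) := by positivity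
    linarith

end Covering

/-! ### Existence of optimal subspace packings -/

section Packings

variable {r : Type*} {p : ℕ}

open Classical in
/-- The frame of the coordinate subspace spanned by the standard basis vectors `e i`. -/
def coordFrame (e : Fin p → r) : Matrix r (Fin p) ℂ :=
  (1 : Matrix r r ℂ).submatrix id e

variable [Fintype r]

theorem truncatedUnitary_coordFrame {e : Fin p → r} (he : Function.Injective e) :
    TruncatedUnitary (coordFrame e) := by
  classical
  rw [TruncatedUnitary, coordFrame, Matrix.conjTranspose_submatrix, Matrix.conjTranspose_one]
  refine (Matrix.submatrix_mul_equiv 1 1 e (Equiv.refl r) e).trans ?_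
  rw [Matrix.one_mul]
  convert Matrix.submatrix_one e he

theorem exists_truncatedUnitary (h : p ≤ Fintype.card r) :
    ∃ X : Matrix r (Fin p) ℂ, TruncatedUnitary X := by
  obtain ⟨e⟩ := Function.Embedding.nonempty_of_card_le (α := Fin p) (β := r) (by simpa using h)
  exact ⟨_, truncatedUnitary_coordFrame e.injective⟩

theorem continuous_minDist {m : ℕ} {pairs : Finset (Fin m × Fin m)} (hne : pairs.Nonempty) :
    Continuous fun c : Fin m → Matrix r (Fin p) ℂ =>
      pairs.inf' hne fun x => chordalDist (c x.1) (c x.2) := by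
  have h : ∀ x : Fin m × Fin m, Continuous fun c : Fin m → Matrix r (Fin p) ℂ =>
      chordalDist (c x.1) (c x.2) := fun x =>
    continuous_chordalDist.comp
      (f := fun c : Fin m → Matrix r (Fin p) ℂ => (c x.1, c x.2)) (by fun_prop)
  exact Continuous.finset_inf'_apply hne fun x _ => h x

/-- Compactness gives codes of maximal minimum distance, but such a code need not be saturated.
Among them, one with the fewest pairs at that distance is: an uncovered subspace could replace an
endpoint of a closest pair and remove a tie. -/
theorem exists_optimal_packing {m : ℕ} (hm : 0 < m) (h : p ≤ Fintype.card r) :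
    ∃ code : Fin m → Matrix r (Fin p) ℂ, IsSubspacePacking code ∧ IsMaxMinOptimal code := by
  classical
  obtain ⟨X₀, hX₀⟩ := exists_truncatedUnitary h
  obtain hm1 | hm2 := Nat.eq_or_lt_of_le hm
  · refine ⟨fun _ => X₀, ⟨fun _ => hX₀, (1 + p) * Real.sqrt p, ?_, ?_⟩, ?_⟩
    · intro a b hab
      exact absurd (Fin.ext (by omega)) hab
    · intro X hX
      exact ⟨⟨0, hm⟩, hX₀.chordalDist_le hX⟩
    · intro _ _ _ _ a b hab
      exact absurd (Fin.ext (by omega)) hab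
  set pairs : Finset (Fin m × Fin m) := Finset.univ.filter fun x => x.1 ≠ x.2 with hpairs
  have hne : pairs.Nonempty :=
    ⟨(⟨0, hm⟩, ⟨1, by omega⟩), by simp [hpairs]⟩
  have hmem : ∀ {a b : Fin m}, a ≠ b → (a, b) ∈ pairs := fun hab => by simp [hpairs, hab]
  set md : (Fin m → Matrix r (Fin p) ℂ) → ℝ := fun c =>
    pairs.inf' hne fun x => chordalDist (c x.1) (c x.2) with hmd
  have hmdc : Continuous md := continuous_minDist hne
  have hcpt : IsCompact (Set.pi Set.univ fun _ : Fin m =>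
      {X : Matrix r (Fin p) ℂ | TruncatedUnitary X}) :=
    isCompact_univ_pi fun _ => isCompact_truncatedUnitary
  obtain ⟨c₀, hc₀, hmax⟩ := hcpt.exists_isMaxOn ⟨fun _ => X₀, fun _ _ => hX₀⟩ hmdc.continuousOn
  set ties : (Fin m → Matrix r (Fin p) ℂ) → Finset (Fin m × Fin m) := fun c =>
    pairs.filter fun x => chordalDist (c x.1) (c x.2) = md c₀ with hties
  obtain ⟨c, ⟨hcTU, hcmd⟩, hcmin⟩ := (measure fun c => (ties c).card).wf.has_min
    {c | (∀ a, TruncatedUnitary (c a)) ∧ md c = md c₀} ⟨c₀, fun a => hc₀ a trivial, rfl⟩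
  have hle : ∀ a b, a ≠ b → md c₀ ≤ chordalDist (c a) (c b) := fun a b hab => by
    rw [← hcmd]; exact Finset.inf'_le (fun x : Fin m × Fin m => chordalDist (c x.1) (c x.2)) (hmem hab)
  refine ⟨c, ⟨hcTU, md c₀, hle, ?_⟩, ?_⟩
  · intro X hX
    by_contra! hfar
    obtain ⟨⟨a, b⟩, habp, hab⟩ := Finset.exists_mem_eq_inf' hne
      fun x : Fin m × Fin m => chordalDist (c x.1) (c x.2)
    have hab' : chordalDist (c a) (c b) = md c₀ := by rw [← hcmd, hmd]; exact hab.symm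
    -- Pairs involving the new codeword are strictly farther apart than `md c₀`; all other distances
    -- are unchanged.
    set c' := Function.update c a X with hc'
    have hTU' : ∀ x, TruncatedUnitary (c' x) := fun x => by
      by_cases hx : x = a
      · subst hx; simpa [hc'] using hX
      · simpa [hc', hx] using hcTU x
    have hval : ∀ x y, x ≠ y → md c₀ < chordalDist (c' x) (c' y) ∨
        (x ≠ a ∧ y ≠ a ∧ chordalDist (c' x) (c' y) = chordalDist (c x) (c y)) := by
      intro x y hxy
      by_cases hx : x = a
      · subst hx
        left
        simpa [hc', hxy.symm, chordalDist_comm X] using hfar y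
      · by_cases hy : y = a
        · subst hy
          left
          simpa [hc', hx] using hfar x
        · right
          exact ⟨hx, hy, by simp [hc', hx, hy]⟩
    have hmd' : md c' = md c₀ := by
      refine le_antisymm (hmax (fun x _ => hTU' x)) ?_
      refine Finset.le_inf' hne _ fun x hx => ?_
      have hx' : x.1 ≠ x.2 := by simpa [hpairs] using hx
      rcases hval x.1 x.2 hx' with h1 | ⟨-, -, h1⟩
      · exact h1.le
      · rw [h1]; exact hle _ _ hx'
    refine hcmin c' ⟨hTU', hmd'⟩ (Finset.card_lt_card ⟨?_, ?_⟩)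
    · intro x hx
      rw [hties, Finset.mem_filter] at hx ⊢
      have hx' : x.1 ≠ x.2 := by simpa [hpairs] using hx.1
      rcases hval x.1 x.2 hx' with h1 | ⟨-, -, h1⟩
      · exact absurd hx.2 h1.ne'
      · exact ⟨hx.1, h1 ▸ hx.2⟩
    · intro hsub
      have h1 := hsub (show (a, b) ∈ ties c from Finset.mem_filter.2 ⟨habp, hab'⟩)
      rw [hties, Finset.mem_filter] at h1
      rcases hval a b (by simpa [hpairs] using habp) with h2 | ⟨h2, -⟩
      · exact h2.ne' h1.2
      · exact h2 rfl
  · intro code' hcode' δ hδ a b hab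
    refine le_trans ?_ (hle a b hab)
    refine le_trans (Finset.le_inf' hne _ fun x hx => ?_) (hmax (fun x _ => hcode' x))
    exact hδ _ _ (by simpa [hpairs] using hx)

theorem exists_optimal_quantizer (h : p ≤ Fintype.card r) :
    ∃ q : Quantizer r p, ∀ n, IsMaxMinOptimal (q.code n) := by
  choose code hpack hopt using fun n : ℕ =>
    exists_optimal_packing (r := r) (p := p) (m := 2 ^ n) (by positivity) h
  choose index hindex using fun (n : ℕ) (X : Matrix r (Fin p) ℂ) =>
    haveI : Nonempty (Fin (2 ^ n)) := ⟨⟨0, by positivity⟩⟩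
    Finite.exists_min fun a => chordalDist (code n a) X
  exact ⟨⟨code, hpack, index, hindex⟩, hopt⟩

end Packings

/-! ### Lebesgue measure on the space of channels -/

section ChannelMeasure

/-- Channels form an iterated function space, so the Haar property is passed up one level at a time.
It supplies translation invariance, scaling of null sets and density of conull sets. -/
instance isAddHaarMeasure_volume_pi (ι : Type*) [Fintype ι] (E : Type*) [AddGroup E]
    [TopologicalSpace E] [MeasureSpace E] [(volume : Measure E).IsAddHaarMeasure]
    [SigmaFinite (volume : Measure E)] [MeasurableAdd E] :
    (volume : Measure (ι → E)).IsAddHaarMeasure :=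
  inferInstanceAs (Measure.pi fun _ => volume).IsAddHaarMeasure

instance isAddHaarMeasure_volume_link (N M : ℕ) :
    (volume : Measure (Fin N → Fin M → ℂ)).IsAddHaarMeasure := inferInstance

instance isAddHaarMeasure_volume_links (K N M : ℕ) :
    (volume : Measure (Fin K → Fin N → Fin M → ℂ)).IsAddHaarMeasure := inferInstance

instance isAddHaarMeasure_volume_channel (K N M : ℕ) :
    (volume : Measure (Channel K N M)).IsAddHaarMeasure :=
  isAddHaarMeasure_volume_pi (Fin K) (Fin K → Fin N → Fin M → ℂ)

instance borelSpace_link (N M : ℕ) : BorelSpace (Fin N → Fin M → ℂ) := inferInstance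

instance borelSpace_links (K N M : ℕ) : BorelSpace (Fin K → Fin N → Fin M → ℂ) := inferInstance

instance borelSpace_channel (K N M : ℕ) : BorelSpace (Channel K N M) := inferInstance

end ChannelMeasure

/-! ### Alignment for all channels -/

section Alignment

variable {K N M d : ℕ}

open scoped ComplexOrder in
theorem IsIASolution.rank_eq {H : Channel K N M} {U : Fin K → Matrix (Fin N) (Fin d) ℂ}
    {V : Fin K → Matrix (Fin M) (Fin d) ℂ} (h : IsIASolution H U V) (i : Fin K) :
    (U i).rank = d ∧ (V i).rank = d := by
  have h1 := h.2 i
  have h2 : d ≤ (V i).rank := by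
    conv_lhs => rw [← h1]
    exact Matrix.rank_mul_le_right _ _
  have h3 : d ≤ (U i).rank := by
    rw [← Matrix.rank_conjTranspose (U i)]
    conv_lhs => rw [← h1, Matrix.mul_assoc]
    exact Matrix.rank_mul_le_left _ _
  exact ⟨le_antisymm (Matrix.rank_le_width _) h3, le_antisymm (Matrix.rank_le_width _) h2⟩

theorem eq_zero_of_mul_isUnit {N M d : ℕ} {U : Matrix (Fin N) (Fin d) ℂ}
    {V : Matrix (Fin M) (Fin d) ℂ} {A : Matrix (Fin N) (Fin M) ℂ} {B C : Matrix (Fin d) (Fin d) ℂ}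
    (hB : B.det ≠ 0) (hC : C.det ≠ 0) (h : (U * B)ᴴ * A * (V * C) = 0) : Uᴴ * A * V = 0 := by
  have hB' : IsUnit B.det := isUnit_iff_ne_zero.2 hB
  have hC' : IsUnit C.det := isUnit_iff_ne_zero.2 hC
  have h1 : (B⁻¹)ᴴ * ((U * B)ᴴ * A * (V * C)) * C⁻¹ = Uᴴ * A * V := by
    have h2 : (B⁻¹)ᴴ * Bᴴ = 1 := by
      rw [← Matrix.conjTranspose_mul, Matrix.mul_nonsing_inv _ hB', Matrix.conjTranspose_one]
    calc _ = ((B⁻¹)ᴴ * Bᴴ) * (Uᴴ * A * V) * (C * C⁻¹) := by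
          simp only [Matrix.conjTranspose_mul, Matrix.mul_assoc]
      _ = _ := by rw [h2, Matrix.mul_nonsing_inv _ hC', Matrix.one_mul, Matrix.mul_one]
  rw [← h1, h, Matrix.mul_zero, Matrix.zero_mul]

/-- Truncated unitary filters and precoders that align interference exist for every channel when
alignment is feasible. -/
theorem IAFeasible.exists_aligned (hfeas : IAFeasible K N M d) (H : Channel K N M) :
    ∃ (U : Fin K → Matrix (Fin N) (Fin d) ℂ) (V : Fin K → Matrix (Fin M) (Fin d) ℂ),
      (∀ i, TruncatedUnitary (U i)) ∧ (∀ i, TruncatedUnitary (V i)) ∧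
        ∀ i j, j ≠ i → (U i)ᴴ * H.mat i j * V j = 0 := by
  have hae : ∀ᵐ H : Channel K N M, ∃ (U : Fin K → Matrix (Fin N) (Fin d) ℂ)
      (V : Fin K → Matrix (Fin M) (Fin d) ℂ),
      (∀ i, TruncatedUnitary (U i)) ∧ (∀ i, TruncatedUnitary (V i)) ∧
        ∀ i j, j ≠ i → (U i)ᴴ * H.mat i j * V j = 0 := by
    filter_upwards [hfeas] with H hH
    obtain ⟨U, V, hUV⟩ := hH
    choose F C hF hC hFC using fun i => exists_truncatedUnitary_mul
      (det_conjTranspose_mul_self_ne_zero (hUV.rank_eq i).1)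
    choose F' C' hF' hC' hFC' using fun i => exists_truncatedUnitary_mul
      (det_conjTranspose_mul_self_ne_zero (hUV.rank_eq i).2)
    refine ⟨F, F', hF, hF', fun i j hij => eq_zero_of_mul_isUnit (hC i) (hC' j) ?_⟩
    rw [← hFC, ← hFC']
    exact hUV.1 i j hij
  -- A conull set is dense. Approximating channels have solutions in a compact set, and the
  -- alignment equations pass to the limit; the rank condition might not, so it is dropped.
  have hdense := Measure.dense_of_ae hae
  obtain ⟨h, hh, hlim⟩ := mem_closure_iff_seq_limit.1 (hdense H)
  choose U V hU hV hUV using hh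
  have hcpt : IsCompact ((Set.pi Set.univ fun _ : Fin K =>
      {X : Matrix (Fin N) (Fin d) ℂ | TruncatedUnitary X}) ×ˢ (Set.pi Set.univ fun _ : Fin K =>
      {X : Matrix (Fin M) (Fin d) ℂ | TruncatedUnitary X})) :=
    (isCompact_univ_pi fun _ => isCompact_truncatedUnitary).prod
      (isCompact_univ_pi fun _ => isCompact_truncatedUnitary)
  have : FirstCountableTopology (Matrix (Fin N) (Fin d) ℂ) :=
    inferInstanceAs (FirstCountableTopology (Fin N → Fin d → ℂ))
  have : FirstCountableTopology (Matrix (Fin M) (Fin d) ℂ) :=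
    inferInstanceAs (FirstCountableTopology (Fin M → Fin d → ℂ))
  obtain ⟨⟨U₀, V₀⟩, hUV₀, φ, hφ, hφlim⟩ := hcpt.tendsto_subseq (x := fun k => (U k, V k))
    fun k => ⟨fun i _ => hU k i, fun i _ => hV k i⟩
  refine ⟨U₀, V₀, fun i => hUV₀.1 i trivial, fun i => hUV₀.2 i trivial, fun i j hij => ?_⟩
  have hlim' := (hlim.comp hφ.tendsto_atTop).prodMk_nhds hφlim
  have hcont : Continuous fun z : Channel K N M ×
      (Fin K → Matrix (Fin N) (Fin d) ℂ) × (Fin K → Matrix (Fin M) (Fin d) ℂ) =>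
      (z.2.1 i)ᴴ * z.1.mat i j * z.2.2 j := by
    have h1 : Continuous fun z : Channel K N M ×
      (Fin K → Matrix (Fin N) (Fin d) ℂ) × (Fin K → Matrix (Fin M) (Fin d) ℂ) => z.1.mat i j := by
      refine continuous_matrix fun a b => ?_
      simp only [Channel.mat, Matrix.of_apply]
      fun_prop
    fun_prop
  have h2 := (hcont.tendsto _).comp hlim'
  refine tendsto_nhds_unique h2 (tendsto_const_nhds.congr fun k => ?_)
  exact (hUV (φ k) i j hij).symm

theorem blockFilter_conjTranspose_mul_apply {s : Type*} (U : Fin K → Matrix (Fin N) (Fin d) ℂ)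
    (j : Fin K) (Z : Matrix (CrossRows N j) s ℂ) (k : Fin d) (i : {i : Fin K // i ≠ j}) (c : s) :
    ((blockFilter U j)ᴴ * Z) (k, i) c = ((U i)ᴴ * Z.submatrix (fun n => (n, i)) id) k c := by
  simp only [Matrix.mul_apply, Fintype.sum_prod_type, blockFilter, Matrix.conjTranspose_apply,
    Matrix.blockDiagonal_apply, Matrix.submatrix_apply, id]
  refine Finset.sum_congr rfl fun n _ => ?_
  rw [Finset.sum_eq_single i]
  · simp
  · intro b _ hb
    simp [hb]
  · simp

theorem card_crossRows (N : ℕ) (j : Fin K) : Fintype.card (CrossRows N j) = (K - 1) * N := by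
  have : Fintype.card {i : Fin K // i ≠ j} = K - 1 := by
    simp
  rw [Fintype.card_prod, this, Fintype.card_fin, mul_comm]

theorem IAFeasible.exists_isIASolution (hfeas : IAFeasible K N M d) :
    ∃ (H : Channel K N M) (U : Fin K → Matrix (Fin N) (Fin d) ℂ)
      (V : Fin K → Matrix (Fin M) (Fin d) ℂ), IsIASolution H U V :=
  (Measure.dense_of_ae hfeas).nonempty

theorem IAFeasible.le (hfeas : IAFeasible K N M d) (hK : 0 < K) : d ≤ M := by
  obtain ⟨H, U, V, h⟩ := hfeas.exists_isIASolution
  rw [← (h.rank_eq ⟨0, hK⟩).2]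
  exact Matrix.rank_le_height _

theorem IAFeasible.exists_optimal_scheme (hfeas : IAFeasible K N M d) (hM : M < (K - 1) * N) :
    ∃ σ : Scheme K N M d, σ.Optimal := by
  have hK : 0 < K := by
    rcases K.eq_zero_or_pos with h | h
    · subst h; simp at hM
    · exact h
  choose qb hqb using fun j : Fin K => exists_optimal_quantizer (r := CrossRows N j) (p := M)
    (by rw [card_crossRows]; exact hM.le)
  obtain ⟨qc, hqc⟩ := exists_optimal_quantizer (r := Fin M) (p := d)
    (by rw [Fintype.card_fin]; exact hfeas.le hK)
  choose U V hU hV hUV using fun G : (j : Fin K) → Matrix (CrossRows N j) (Fin M) ℂ =>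
    -- The reconstructed stacks are read as a channel with zero direct links, which alignment does
    -- not involve.
    hfeas.exists_aligned fun i j n m => if h : i ≠ j then G j (n, ⟨i, h⟩) m else 0
  refine ⟨⟨qb, fun _ => qc, U, V, fun G _ => hU G, fun G _ => hV G, fun G _ j => ?_⟩,
    hqb, fun _ => hqc⟩
  ext ⟨k, i⟩ c
  rw [Matrix.mul_assoc, blockFilter_conjTranspose_mul_apply]
  have h := congrFun (congrFun (hUV G i j i.2.symm) k) c
  rw [Matrix.mul_assoc] at h
  refine Eq.trans ?_ h
  have hG : (G j * V G j).submatrix (fun n => (n, i)) id = Channel.mat (fun i j n m =>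
      if h : i ≠ j then G j (n, ⟨i, h⟩) m else 0) i j * V G j := by
    ext n m
    simp only [Matrix.submatrix_apply, id, Channel.mat, Matrix.mul_apply, Matrix.of_apply]
    refine Finset.sum_congr rfl fun x _ => ?_
    rw [dif_pos i.2]
  rw [hG]

end Alignment

/-! ### Interference leakage -/

section Leakage

variable {K N M d : ℕ}

theorem TruncatedUnitary.proj_mul_self {r : Type*} [Fintype r] {p : ℕ} {X : Matrix r (Fin p) ℂ}
    (hX : TruncatedUnitary X) : X * Xᴴ * X = X := by
  rw [Matrix.mul_assoc, show Xᴴ * X = 1 from hX, Matrix.mul_one]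

theorem trace_interferenceCov (H : Channel K N M) (U : Fin K → Matrix (Fin N) (Fin d) ℂ)
    (V : Fin K → Matrix (Fin M) (Fin d) ℂ) (i : Fin K) :
    Matrix.trace (interferenceCov H U V i) =
      ((∑ j ∈ Finset.univ.erase i, frob ((U i)ᴴ * H.mat i j * V j) ^ 2 : ℝ) : ℂ) := by
  rw [interferenceCov, Matrix.trace_sum]
  push_cast
  refine Finset.sum_congr rfl fun j _ => ?_
  have h := trace_mul_conjTranspose_self ((U i)ᴴ * H.mat i j * V j)
  push_cast at h
  rw [← h]
  simp only [Matrix.conjTranspose_mul, Matrix.conjTranspose_conjTranspose, Matrix.mul_assoc]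

theorem leakage_eq (H : Channel K N M) (U : Fin K → Matrix (Fin N) (Fin d) ℂ)
    (V : Fin K → Matrix (Fin M) (Fin d) ℂ) (P : ℝ) (i : Fin K) :
    leakage H U V P i =
      P / d * ∑ j ∈ Finset.univ.erase i, frob ((U i)ᴴ * H.mat i j * V j) ^ 2 := by
  rw [leakage, Matrix.trace_smul, trace_interferenceCov, smul_eq_mul, ← Complex.ofReal_mul,
    Complex.ofReal_re]

namespace Scheme

variable (σ : Scheme K N M d) {F : (j : Fin K) → Matrix (CrossRows N j) (Fin M) ℂ}
  {C : Fin K → Matrix (Fin M) (Fin M) ℂ}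

theorem truncatedUnitary_Fhat (F : (j : Fin K) → Matrix (CrossRows N j) (Fin M) ℂ) (P : ℝ)
    (j : Fin K) : TruncatedUnitary (σ.Fhat F P j) :=
  (σ.bsQuant j).truncatedUnitary_quantize _ _

theorem truncatedUnitary_Vhat (F : (j : Fin K) → Matrix (CrossRows N j) (Fin M) ℂ) (P : ℝ)
    (j : Fin K) : TruncatedUnitary (σ.Vhat F P j) :=
  (σ.cnQuant j).truncatedUnitary_quantize _ _

theorem truncatedUnitary_U (F : (j : Fin K) → Matrix (CrossRows N j) (Fin M) ℂ) (P : ℝ)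
    (i : Fin K) : TruncatedUnitary (σ.U F P i) :=
  σ.filters_unitary _ (σ.truncatedUnitary_Fhat F P) i

theorem truncatedUnitary_precoders (F : (j : Fin K) → Matrix (CrossRows N j) (Fin M) ℂ) (P : ℝ)
    (i : Fin K) : TruncatedUnitary (σ.precoders (σ.Fhat F P) i) :=
  σ.precoders_unitary _ (σ.truncatedUnitary_Fhat F P) i

/-- Two errors are split off: `F Fᴴ` is replaced by `F̂ F̂ᴴ`, which fixes `F̂`, and `V̂` by its
component along `Ṽ`, which is aligned exactly. What remains is linear in the differences of
projectors. -/
theorem frob_interference_le {H : Channel K N M}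
    (hFC : ∀ j, H.stack j = F j * C j) (hC : ∀ j, (C j).det ≠ 0) (P : ℝ) {i j : Fin K}
    (hij : i ≠ j) :
    frob ((σ.U F P i)ᴴ * H.mat i j * σ.V F C P j) ≤
      d * Real.sqrt M * Real.sqrt 2 * (chordalDist (σ.Fhat F P j) (F j) +
        chordalDist (σ.Vhat F P j) (σ.precoders (σ.Fhat F P) j)) := by
  have hCu : IsUnit (C j).det := isUnit_iff_ne_zero.2 (hC j)
  set e : Fin N → CrossRows N j := fun n => (n, ⟨i, hij⟩) with he
  have hinj : Function.Injective e := fun a b h => congrArg Prod.fst h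
  set Fh := σ.Fhat F P j with hFh
  set Vh := σ.Vhat F P j with hVh
  set Vt := σ.precoders (σ.Fhat F P) j with hVt
  set U := σ.U F P i with hU
  have hFhT : TruncatedUnitary Fh := σ.truncatedUnitary_Fhat F P j
  have hVhT : TruncatedUnitary Vh := σ.truncatedUnitary_Vhat F P j
  have hVtT : TruncatedUnitary Vt := σ.truncatedUnitary_precoders F P j
  have hUT : TruncatedUnitary U := σ.truncatedUnitary_U F P i
  have halign : Uᴴ * Fh.submatrix e id * Vt = 0 := by
    have h := σ.aligned _ (σ.truncatedUnitary_Fhat F P) j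
    ext k c
    have h2 := congrFun (congrFun h (k, ⟨i, hij⟩)) c
    rw [Matrix.mul_assoc, blockFilter_conjTranspose_mul_apply] at h2
    rw [Matrix.mul_assoc]
    exact h2
  have h1 : H.stack j * σ.V F C P j = (F j * (F j)ᴴ - Fh * Fhᴴ) * Fh * Vh + Fh * Vh := by
    have h2 : Fh * Fhᴴ * Fh = Fh := hFhT.proj_mul_self
    rw [Matrix.sub_mul, h2, Matrix.sub_mul, sub_add_cancel, hFC j, Scheme.V]
    calc F j * C j * ((C j)⁻¹ * (F j)ᴴ * Fh * Vh) =
        F j * (C j * (C j)⁻¹) * (F j)ᴴ * Fh * Vh := by simp only [Matrix.mul_assoc]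
      _ = _ := by rw [Matrix.mul_nonsing_inv _ hCu, Matrix.mul_one]
  have h2 : H.mat i j * σ.V F C P j =
      (F j * (F j)ᴴ - Fh * Fhᴴ).submatrix e id * Fh * Vh + Fh.submatrix e id * Vh := by
    have := congrArg (fun Z => Matrix.submatrix Z e id) h1
    exact this
  have h3 : Uᴴ * (Fh.submatrix e id * Vh) =
      Uᴴ * Fh.submatrix e id * (Vh * Vhᴴ - Vt * Vtᴴ) * Vh := by
    have h4 : Vh * Vhᴴ * Vh = Vh := hVhT.proj_mul_self
    rw [Matrix.mul_sub, Matrix.sub_mul, Matrix.mul_assoc _ (Vh * Vhᴴ), h4, ← Matrix.mul_assoc _ Vt,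
      halign, Matrix.zero_mul, Matrix.zero_mul, sub_zero, Matrix.mul_assoc]
  have hUf : frob Uᴴ = Real.sqrt d := by rw [frob_conjTranspose, hUT.frob_eq]
  have hd : Real.sqrt d * Real.sqrt d = d := Real.mul_self_sqrt (Nat.cast_nonneg d)
  have hb1 : frob (Uᴴ * ((F j * (F j)ᴴ - Fh * Fhᴴ).submatrix e id * Fh * Vh)) ≤
      Real.sqrt d * ((Real.sqrt 2 * chordalDist Fh (F j)) * Real.sqrt M * Real.sqrt d) := by
    refine (frob_mul_le _ _).trans ?_
    rw [hUf]
    refine mul_le_mul_of_nonneg_left ((frob_mul₃_le _ _ _).trans ?_) (Real.sqrt_nonneg _)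
    rw [hFhT.frob_eq, hVhT.frob_eq, chordalDist_comm, ← frob_sub_eq_chordalDist]
    gcongr
    exact frob_submatrix_le hinj _
  have hb2 : frob (Uᴴ * Fh.submatrix e id * (Vh * Vhᴴ - Vt * Vtᴴ) * Vh) ≤
      Real.sqrt d * Real.sqrt M * (Real.sqrt 2 * chordalDist Vh Vt) * Real.sqrt d := by
    refine (frob_mul₃_le _ _ _).trans ?_
    rw [hVhT.frob_eq, ← frob_sub_eq_chordalDist]
    have h5 : frob (Uᴴ * Fh.submatrix e id) ≤ Real.sqrt d * Real.sqrt M := by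
      refine (frob_mul_le _ _).trans ?_
      rw [hUf]
      refine mul_le_mul_of_nonneg_left ?_ (Real.sqrt_nonneg _)
      rw [← hFhT.frob_eq]
      exact frob_submatrix_le hinj _
    gcongr
    exact frob_nonneg _
  rw [Matrix.mul_assoc, h2, Matrix.mul_add, h3]
  refine (frob_add_le _ _).trans ((add_le_add hb1 hb2).trans (le_of_eq ?_))
  linear_combination (Real.sqrt M * Real.sqrt 2 * (chordalDist Fh (F j) + chordalDist Vh Vt)) * hd

end Scheme

/-- The leakage is bounded uniformly in the scheme, the channel and the power. -/
theorem exists_leakage_bound (K N M d : ℕ) : ∃ c₀ : ℝ, ∀ (σ : Scheme K N M d) (H : Channel K N M)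
    (F : (j : Fin K) → Matrix (CrossRows N j) (Fin M) ℂ) (C : Fin K → Matrix (Fin M) (Fin M) ℂ),
    (∀ j, TruncatedUnitary (F j)) → (∀ j, H.stack j = F j * C j) → (∀ j, (C j).det ≠ 0) →
    ∀ i, ∀ P : ℝ, 1 ≤ P → leakage H (σ.U F P) (σ.V F C P) P i ≤ c₀ := by
  -- The constant is chosen for each `j` only because the row index types differ.
  choose cb hcb0 hcb using fun j : Fin K => exists_quantize_error_bound (CrossRows N j) M
  obtain ⟨cc, hcc0, hcc⟩ := exists_quantize_error_bound (Fin M) d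
  refine ⟨1 / d * ∑ j, (d * Real.sqrt M * Real.sqrt 2 * (cb j + cc)) ^ 2,
    fun σ H F C hF hFC hC i P hP => ?_⟩
  rw [leakage_eq, div_mul_eq_mul_div, one_div_mul_eq_div]
  refine div_le_div_of_nonneg_right ?_ (Nat.cast_nonneg d)
  rw [Finset.mul_sum]
  refine (Finset.sum_le_sum fun j hj => ?_).trans
    (Finset.sum_le_sum_of_subset_of_nonneg (Finset.erase_subset i _) fun _ _ _ => by positivity)
  have hij : i ≠ j := (Finset.ne_of_mem_erase hj).symm
  have hP0 : 0 ≤ P := by linarith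
  refine le_of_eq_of_le (b := (Real.sqrt P *
    frob ((σ.U F P i)ᴴ * H.mat i j * σ.V F C P j)) ^ 2) (by rw [mul_pow, Real.sq_sqrt hP0]) ?_
  refine pow_le_pow_left₀ (mul_nonneg (Real.sqrt_nonneg _) (frob_nonneg _)) ?_ 2
  have h1 := σ.frob_interference_le hFC hC P hij
  have h2 := hcb j (σ.bsQuant j) P hP (F j) (hF j)
  have h3 := hcc (σ.cnQuant j) P hP _ (σ.truncatedUnitary_precoders F P j)
  rw [card_crossRows] at h2
  rw [Fintype.card_fin] at h3
  calc Real.sqrt P * frob ((σ.U F P i)ᴴ * H.mat i j * σ.V F C P j) ≤ Real.sqrt P * _ :=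
        mul_le_mul_of_nonneg_left h1 (Real.sqrt_nonneg _)
    _ = d * Real.sqrt M * Real.sqrt 2 * (Real.sqrt P * chordalDist (σ.Fhat F P j) (F j) +
        Real.sqrt P * chordalDist (σ.Vhat F P j) (σ.precoders (σ.Fhat F P) j)) := by ring
    _ ≤ _ := mul_le_mul_of_nonneg_left (add_le_add h2 h3) (by positivity)

end Leakage

/-! ### Determinants and rates -/

section Rates

variable {K N M d : ℕ}

section
open scoped ComplexOrder

/-- The characteristic polynomial evaluated at `-1`, with the sign `(-1) ^ d` cancelled. -/
theorem _root_.Matrix.PosSemidef.det_one_add_eq {X : Matrix (Fin d) (Fin d) ℂ}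
    (hX : X.PosSemidef) :
    (1 + X).det = ((∏ i, (1 + hX.isHermitian.eigenvalues i) : ℝ) : ℂ) := by
  have h1 := Matrix.eval_charpoly X (-1)
  have h2 : Matrix.scalar (Fin d) (-1 : ℂ) - X = -(1 + X) := by
    rw [map_neg, map_one]; abel
  rw [h2, Matrix.det_neg, Fintype.card_fin, hX.isHermitian.charpoly_eq,
    Polynomial.eval_prod] at h1
  simp only [Polynomial.eval_sub, Polynomial.eval_X, Polynomial.eval_C] at h1
  have h3 : ∏ i, ((-1 : ℂ) - ((hX.isHermitian.eigenvalues i : ℝ) : ℂ)) =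
      (-1) ^ d * ∏ i, (1 + ((hX.isHermitian.eigenvalues i : ℝ) : ℂ)) := by
    have h : ((-1 : ℂ)) ^ d = ∏ _i : Fin d, (-1 : ℂ) := by simp
    rw [h, ← Finset.prod_mul_distrib]
    exact Finset.prod_congr rfl fun i _ => by ring
  have h4 : ((-1 : ℂ)) ^ d ≠ 0 := pow_ne_zero _ (by norm_num)
  have h5 := mul_left_cancel₀ h4 (h3.symm.trans h1)
  rw [← h5]; push_cast; rfl

theorem _root_.Matrix.PosSemidef.one_le_det_one_add {X : Matrix (Fin d) (Fin d) ℂ}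
    (hX : X.PosSemidef) : 1 ≤ (1 + X).det.re := by
  rw [hX.det_one_add_eq, Complex.ofReal_re]
  calc (1 : ℝ) = ∏ _i : Fin d, 1 := by simp
    _ ≤ _ := Finset.prod_le_prod (fun _ _ => zero_le_one) fun i _ => by
        have := hX.eigenvalues_nonneg i
        linarith

/-- Each eigenvalue is at most the trace, which turns a bound on the leakage power into one on the
log-determinant. -/
theorem _root_.Matrix.PosSemidef.det_one_add_le {X : Matrix (Fin d) (Fin d) ℂ}
    (hX : X.PosSemidef) : (1 + X).det.re ≤ (1 + (Matrix.trace X).re) ^ d := by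
  rw [hX.det_one_add_eq, Complex.ofReal_re]
  have ht : (Matrix.trace X).re = ∑ i, hX.isHermitian.eigenvalues i := by
    rw [hX.isHermitian.trace_eq_sum_eigenvalues]
    simp
  rw [ht]
  calc ∏ i, (1 + hX.isHermitian.eigenvalues i) ≤
      ∏ _i : Fin d, (1 + ∑ j, hX.isHermitian.eigenvalues j) := by
        refine Finset.prod_le_prod (fun i _ => ?_) fun i _ => ?_
        · have := hX.eigenvalues_nonneg i
          linarith
        · have := Finset.single_le_sum (fun j _ => hX.eigenvalues_nonneg j) (Finset.mem_univ i)
          linarith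
    _ = _ := by simp

/-- Adding a positive semidefinite matrix to `G Gᴴ` does not decrease the determinant. -/
theorem _root_.Matrix.PosSemidef.normSq_det_le {X : Matrix (Fin d) (Fin d) ℂ}
    (hX : X.PosSemidef) (G : Matrix (Fin d) (Fin d) ℂ) (hG : G.det ≠ 0) :
    ‖G.det‖ ^ 2 ≤ (G * Gᴴ + X).det.re := by
  have hu : IsUnit G.det := isUnit_iff_ne_zero.2 hG
  have hY : (G⁻¹ * X * (G⁻¹)ᴴ).PosSemidef := hX.mul_mul_conjTranspose_same _
  have h2 : Gᴴ⁻¹ = (G⁻¹)ᴴ := (Matrix.conjTranspose_nonsing_inv G).symm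
  have hu' : IsUnit (Gᴴ).det := by
    rw [Matrix.det_conjTranspose]; exact hu.star
  -- Factoring out `G` leaves `det (1 + Y)` with `Y` positive semidefinite, which is at least 1.
  have h3 : G * (1 + G⁻¹ * X * (G⁻¹)ᴴ) * Gᴴ = G * Gᴴ + X := by
    rw [Matrix.mul_add, Matrix.add_mul, Matrix.mul_one, ← h2]
    congr 1
    calc G * (G⁻¹ * X * Gᴴ⁻¹) * Gᴴ = (G * G⁻¹) * X * (Gᴴ⁻¹ * Gᴴ) := by
          simp only [Matrix.mul_assoc]
      _ = X := by rw [Matrix.mul_nonsing_inv _ hu, Matrix.nonsing_inv_mul _ hu', Matrix.one_mul,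
          Matrix.mul_one]
  have h4 : (G * Gᴴ + X).det = ((‖G.det‖ ^ 2 : ℝ) : ℂ) * (1 + G⁻¹ * X * (G⁻¹)ᴴ).det := by
    rw [← h3, Matrix.det_mul, Matrix.det_mul, Matrix.det_conjTranspose, Complex.star_def,
      mul_right_comm, Complex.mul_conj, Complex.normSq_eq_norm_sq]
  rw [h4, Complex.re_ofReal_mul]
  exact le_mul_of_one_le_right (by positivity) hY.one_le_det_one_add

theorem posSemidef_interferenceCov (H : Channel K N M) (U : Fin K → Matrix (Fin N) (Fin d) ℂ)
    (V : Fin K → Matrix (Fin M) (Fin d) ℂ) (i : Fin K) :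
    (interferenceCov H U V i).PosSemidef := by
  refine Matrix.posSemidef_sum _ fun j _ => ?_
  have := Matrix.posSemidef_self_mul_conjTranspose ((U i)ᴴ * H.mat i j * V j)
  simpa only [Matrix.conjTranspose_mul, Matrix.conjTranspose_conjTranspose, Matrix.mul_assoc]
    using this

theorem signalCov_eq (H : Channel K N M) (U : Fin K → Matrix (Fin N) (Fin d) ℂ)
    (V : Fin K → Matrix (Fin M) (Fin d) ℂ) (i : Fin K) :
    signalCov H U V i = ((U i)ᴴ * H.mat i i * V i) * ((U i)ᴴ * H.mat i i * V i)ᴴ := by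
  simp only [signalCov, Matrix.conjTranspose_mul, Matrix.conjTranspose_conjTranspose,
    Matrix.mul_assoc]

theorem _root_.Matrix.PosSemidef.ofReal_smul {X : Matrix (Fin d) (Fin d) ℂ}
    (hX : X.PosSemidef) {t : ℝ} (ht : 0 ≤ t) : ((t : ℂ) • X).PosSemidef :=
  hX.smul (by exact_mod_cast ht)

variable {H : Channel K N M} {U : Fin K → Matrix (Fin N) (Fin d) ℂ}
  {V : Fin K → Matrix (Fin M) (Fin d) ℂ} {P : ℝ} {i : Fin K}

/-- Lower and upper bounds on the rate of a user in terms of its leakage. -/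
theorem rate_bounds (hd : 0 < d) (hP : 1 ≤ P) {c₀ c₁ g : ℝ} (hc₀ : leakage H U V P i ≤ c₀)
    (hc₁ : frob ((U i)ᴴ * H.mat i i * V i) ^ 2 ≤ c₁) (hg : 0 < g)
    (hgdet : g ≤ ‖((U i)ᴴ * H.mat i i * V i).det‖ ^ 2) :
    d * Real.logb 2 P + (Real.logb 2 g - d * Real.logb 2 d - d * Real.logb 2 (1 + c₀)) ≤
        rate H U V P i ∧
      rate H U V P i ≤ d * Real.logb 2 P + d * Real.logb 2 (1 + c₀ + c₁) := by
  set G := (U i)ᴴ * H.mat i i * V i with hGdef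
  have hd' : (0 : ℝ) < d := by exact_mod_cast hd
  have hd1 : (1 : ℝ) ≤ d := by exact_mod_cast hd
  have hP0 : 0 < P := by linarith
  have hPd : 0 ≤ P / d := by positivity
  have hI := posSemidef_interferenceCov H U V i
  have hI' := hI.ofReal_smul hPd
  have hS : (signalCov H U V i).PosSemidef := by
    rw [signalCov_eq]; exact Matrix.posSemidef_self_mul_conjTranspose _
  have hSI' := (hS.add hI).ofReal_smul hPd
  have hc₀0 : 0 ≤ leakage H U V P i := by
    rw [leakage_eq]
    exact mul_nonneg hPd (Finset.sum_nonneg fun _ _ => by positivity)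
  have hc₁0 : 0 ≤ c₁ := (sq_nonneg _).trans hc₁
  have hG0 : G.det ≠ 0 := by
    intro h
    rw [h, norm_zero] at hgdet
    norm_num at hgdet
    linarith
  have hlog1 : 0 ≤ Real.logb 2
      (1 + ((P / d : ℝ) : ℂ) • interferenceCov H U V i).det.re :=
    Real.logb_nonneg (by norm_num) hI'.one_le_det_one_add
  have hlog2 : Real.logb 2 (1 + ((P / d : ℝ) : ℂ) • interferenceCov H U V i).det.re ≤
      d * Real.logb 2 (1 + c₀) := by
    rw [← Real.logb_pow]
    refine Real.logb_le_logb_of_le (by norm_num) (by linarith [hI'.one_le_det_one_add]) ?_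
    refine hI'.det_one_add_le.trans ?_
    refine pow_le_pow_left₀ ?_ ?_ d
    · have : 0 ≤ leakage H U V P i := hc₀0
      rw [leakage] at this
      linarith
    · have := hc₀
      rw [leakage] at this
      linarith
  have htS : (Matrix.trace (((P / d : ℝ) : ℂ) • (signalCov H U V i + interferenceCov H U V i))).re =
      P / d * frob G ^ 2 + leakage H U V P i := by
    rw [smul_add, Matrix.trace_add, Complex.add_re, leakage, Matrix.trace_smul, signalCov_eq,
      trace_mul_conjTranspose_self, smul_eq_mul, ← Complex.ofReal_mul, Complex.ofReal_re]
  have hlog3 : Real.logb 2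
      (1 + ((P / d : ℝ) : ℂ) • (signalCov H U V i + interferenceCov H U V i)).det.re ≤
      d * Real.logb 2 P + d * Real.logb 2 (1 + c₀ + c₁) := by
    rw [← mul_add, ← Real.logb_mul hP0.ne' (by linarith), ← Real.logb_pow]
    refine Real.logb_le_logb_of_le (by norm_num) (by linarith [hSI'.one_le_det_one_add]) ?_
    refine hSI'.det_one_add_le.trans ?_
    rw [htS]
    refine pow_le_pow_left₀ (by positivity) ?_ d
    have h1 : P / d * frob G ^ 2 ≤ P * c₁ :=
      mul_le_mul (div_le_self hP0.le hd1) hc₁ (sq_nonneg _) hP0.le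
    nlinarith
  have hlog4 : d * Real.logb 2 P + (Real.logb 2 g - d * Real.logb 2 d) ≤ Real.logb 2
      (1 + ((P / d : ℝ) : ℂ) • (signalCov H U V i + interferenceCov H U V i)).det.re := by
    have h1 : d * Real.logb 2 P + (Real.logb 2 g - d * Real.logb 2 d) =
        Real.logb 2 ((P / d) ^ d * g) := by
      rw [Real.logb_mul (by positivity) hg.ne', Real.logb_pow, Real.logb_div hP0.ne' hd'.ne']
      ring
    rw [h1]
    refine Real.logb_le_logb_of_le (by norm_num) (by positivity) ?_
    -- Scaling by `t` writes `P / d` times the signal covariance as `(t G)(t G)ᴴ`; noise and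
    -- interference are the added positive semidefinite part.
    set t := Real.sqrt (P / d) with ht
    have htt : t ^ 2 = P / d := Real.sq_sqrt hPd
    have ht0 : 0 < t := Real.sqrt_pos.2 (by positivity)
    have hX := (Matrix.PosSemidef.one (n := Fin d) (R := ℂ)).add hI'
    have h2 : (1 + ((P / d : ℝ) : ℂ) • (signalCov H U V i + interferenceCov H U V i)) =
        ((t : ℂ) • G) * ((t : ℂ) • G)ᴴ + (1 + ((P / d : ℝ) : ℂ) • interferenceCov H U V i) := by
      rw [smul_add, signalCov_eq, Matrix.conjTranspose_smul, Matrix.smul_mul, Matrix.mul_smul,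
        smul_smul, Complex.star_def, Complex.conj_ofReal, ← Complex.ofReal_mul, ← sq, htt]
      abel
    have hdet : ((t : ℂ) • G).det = (t : ℂ) ^ d * G.det := by
      rw [Matrix.det_smul, Fintype.card_fin]
    have h3 := hX.normSq_det_le ((t : ℂ) • G) (by
      rw [hdet]
      exact mul_ne_zero (pow_ne_zero _ (by exact_mod_cast ht0.ne')) hG0)
    rw [h2]
    refine le_trans ?_ h3
    rw [hdet, norm_mul, norm_pow, Complex.norm_real, Real.norm_of_nonneg ht0.le, mul_pow,
      ← pow_mul, mul_comm d 2, pow_mul, htt]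
    exact mul_le_mul_of_nonneg_left hgdet (by positivity)
  rw [rate]
  constructor <;> linarith

end

/-- A user whose leakage is bounded and whose signal does not degenerate has `d` degrees of
freedom. -/
theorem hasDoF_of_bounds {H : Channel K N M} {U : ℝ → Fin K → Matrix (Fin N) (Fin d) ℂ}
    {V : ℝ → Fin K → Matrix (Fin M) (Fin d) ℂ} {i : Fin K} (hd : 0 < d) {c₀ c₁ : ℝ} {g : ℝ → ℝ}
    (hc₀ : ∀ᶠ P in atTop, leakage H (U P) (V P) P i ≤ c₀)
    (hc₁ : ∀ᶠ P in atTop, frob ((U P i)ᴴ * H.mat i i * V P i) ^ 2 ≤ c₁)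
    (hg : ∀ᶠ P in atTop, 0 < g P ∧ g P ≤ ‖((U P i)ᴴ * H.mat i i * V P i).det‖ ^ 2)
    (hglim : Tendsto (fun P => Real.logb 2 (g P) / Real.logb 2 P) atTop (𝓝 0)) :
    HasDoF (fun P => rate H (U P) (V P) P i) d := by
  have hlogtop : Tendsto (fun P => Real.logb 2 P) atTop atTop :=
    Real.tendsto_logb_atTop (by norm_num)
  have hconst : ∀ a : ℝ, Tendsto (fun P => a / Real.logb 2 P) atTop (𝓝 0) := fun a =>
    hlogtop.const_div_atTop a
  have hlow : Tendsto (fun P => (d : ℝ) + (Real.logb 2 (g P) / Real.logb 2 P +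
      (- d * Real.logb 2 d - d * Real.logb 2 (1 + c₀)) / Real.logb 2 P)) atTop (𝓝 d) := by
    simpa using (hglim.add (hconst _)).const_add (d : ℝ)
  have hupp : Tendsto (fun P => (d : ℝ) + d * Real.logb 2 (1 + c₀ + c₁) / Real.logb 2 P) atTop
      (𝓝 d) := by
    simpa using (hconst _).const_add (d : ℝ)
  refine tendsto_of_tendsto_of_tendsto_of_le_of_le' hlow hupp ?_ ?_
  · filter_upwards [hc₀, hc₁, hg, eventually_gt_atTop 1] with P h0 h1 h2 hP
    have hl : 0 < Real.logb 2 P := Real.logb_pos (by norm_num) hP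
    have h := (rate_bounds hd hP.le h0 h1 h2.1 h2.2).1
    rw [← add_div, le_div_iff₀ hl, add_mul, div_mul_cancel₀ _ hl.ne']
    linarith
  · filter_upwards [hc₀, hc₁, hg, eventually_gt_atTop 1] with P h0 h1 h2 hP
    have hl : 0 < Real.logb 2 P := Real.logb_pos (by norm_num) hP
    have h := (rate_bounds hd hP.le h0 h1 h2.1 h2.2).2
    rw [div_le_iff₀ hl, add_mul, div_mul_cancel₀ _ hl.ne']
    linarith

/-- Interference alignment with perfect channel knowledge. -/
theorem IsIASolution.hasDoF {H : Channel K N M} {U : Fin K → Matrix (Fin N) (Fin d) ℂ}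
    {V : Fin K → Matrix (Fin M) (Fin d) ℂ} (h : IsIASolution H U V) (hd : 0 < d) (i : Fin K) :
    HasDoF (fun P => rate H U V P i) d := by
  set G := (U i)ᴴ * H.mat i i * V i with hG
  have hdet : G.det ≠ 0 := by
    have h1 := det_conjTranspose_mul_self_ne_zero (h.2 i)
    rw [Matrix.det_mul] at h1
    exact right_ne_zero_of_mul h1
  refine hasDoF_of_bounds hd (c₀ := 0) (c₁ := frob G ^ 2) (g := fun _ => ‖G.det‖ ^ 2)
    (Eventually.of_forall fun P => ?_) (Eventually.of_forall fun P => le_rfl)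
    (Eventually.of_forall fun P => ⟨by positivity, le_rfl⟩)
    ((Real.tendsto_logb_atTop (by norm_num)).const_div_atTop _)
  rw [leakage_eq, Finset.sum_eq_zero, mul_zero]
  intro j hj
  rw [h.1 i j (Finset.ne_of_mem_erase hj), frob_eq_zero.2 rfl]
  norm_num

end Rates

/-! ### Almost everywhere statements for Haar measures on vector spaces -/

section NullSets

variable {E : Type*} [NormedAddCommGroup E] [NormedSpace ℝ E] [FiniteDimensional ℝ E]
  [MeasurableSpace E] [BorelSpace E] (μ : Measure E) [μ.IsAddHaarMeasure]

/-- The zeros of a nonzero analytic function on the line are isolated, hence null. -/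
theorem ae_ne_zero_of_analyticOnNhd {F : Type*} [NormedAddCommGroup F] [NormedSpace ℝ F]
    {f : ℝ → F} (hf : AnalyticOnNhd ℝ f Set.univ) {t₀ : ℝ} (h₀ : f t₀ ≠ 0) :
    ∀ᵐ t : ℝ, f t ≠ 0 := by
  have h := hf.preimage_zero_mem_codiscrete h₀
  have h2 := ae_restrict_le_codiscreteWithin (μ := (volume : Measure ℝ)) MeasurableSet.univ h
  rw [Measure.restrict_univ] at h2
  exact h2

/-- A continuous function that is analytic on all lines through a point at which it does not vanish
is nonzero almost everywhere. -/
theorem ae_ne_zero_of_analytic_lines {F : Type*} [NormedAddCommGroup F] [NormedSpace ℝ F]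
    {f : E → F} (hf : Continuous f) {x₀ : E} (h₀ : f x₀ ≠ 0)
    (hline : ∀ x, AnalyticOnNhd ℝ (fun t : ℝ => f (x₀ + t • x)) Set.univ) :
    ∀ᵐ x ∂μ, f x ≠ 0 := by
  have h1 : ∀ᵐ x ∂μ, ∀ᵐ t : ℝ, f (x₀ + t • x) ≠ 0 := Eventually.of_forall fun x =>
    ae_ne_zero_of_analyticOnNhd (hline x) (t₀ := 0) (by simpa using h₀)
  have hmeas : MeasurableSet {z : E × ℝ | f (x₀ + z.2 • z.1) ≠ 0} := by
    have : Continuous fun z : E × ℝ => f (x₀ + z.2 • z.1) := by fun_prop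
    exact (isOpen_ne_fun this continuous_const).measurableSet
  -- Fubini exchanges the quantifiers. One good `t ≠ 0` then suffices, as dilations and translations
  -- preserve null sets.
  have h2 : ∀ᵐ t : ℝ, ∀ᵐ x ∂μ, f (x₀ + t • x) ≠ 0 :=
    (Measure.ae_ae_comm (p := fun x t => f (x₀ + t • x) ≠ 0) hmeas).1 h1
  obtain ⟨t, ht, ht0⟩ := (h2.and (Measure.ae_ne volume (0 : ℝ))).exists
  rw [ae_iff] at ht ⊢
  have h3 : {x | ¬ f (x₀ + t • x) ≠ 0} = (fun x => t • x) ⁻¹' ((fun x => x₀ + x) ⁻¹'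
      {x | ¬ f x ≠ 0}) := rfl
  rw [h3, Measure.addHaar_preimage_smul _ ht0, mul_eq_zero] at ht
  rcases ht with h | h
  · rw [ENNReal.ofReal_eq_zero] at h
    exact absurd h (not_le.2 (by positivity))
  · rwa [measure_preimage_add] at h

/-- If a property holds almost everywhere along almost every translate of a subspace, then it holds
almost everywhere. -/
theorem ae_of_ae_ae_add {W : Type*} [NormedAddCommGroup W] [MeasurableSpace W]
    [BorelSpace W] [SecondCountableTopology W] (ν : Measure W) [SFinite ν] [NeZero ν]
    {ι : W → E} (hι : Continuous ι) {p : E → Prop} (hp : MeasurableSet {x | p x})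
    (h : ∀ᵐ x ∂μ, ∀ᵐ w ∂ν, p (x + ι w)) : ∀ᵐ x ∂μ, p x := by
  have hmeas : MeasurableSet {z : E × W | p (z.1 + ι z.2)} := by
    have : Measurable fun z : E × W => z.1 + ι z.2 := by
      have : Continuous fun z : E × W => z.1 + ι z.2 := by fun_prop
      exact this.measurable
    exact this hp
  have h2 := (Measure.ae_ae_comm (p := fun x w => p (x + ι w)) hmeas).1 h
  -- After the exchange a single `w` suffices, by translation invariance of `μ`.
  obtain ⟨w, hw⟩ := h2.exists
  rw [ae_iff] at hw ⊢
  have h3 : {x | ¬ p (x + ι w)} = (fun x => x + ι w) ⁻¹' {x | ¬ p x} := rfl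
  rwa [h3, measure_preimage_add_right] at hw

/-- The measure of a set is controlled by the length of its intersections with segments in a given
direction. -/
theorem measure_inter_ball_le_of_segments {Z : Set E} (hZ : MeasurableSet Z) {e : E} {δ : ENNReal}
    (h : ∀ x, volume {t : ℝ | x + t • e ∈ Z} ≤ δ) (R : ℝ) :
    μ (Z ∩ Metric.ball 0 R) ≤ δ * μ (Metric.ball 0 (R + ‖e‖)) := by
  set B := Z ∩ Metric.ball (0 : E) R with hB
  have hBm : MeasurableSet B := hZ.inter measurableSet_ball
  -- Double counting: slices at fixed `t` have measure `μ B`; slices at fixed `x`, restricted to `t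
  -- ∈ [0, 1]`, have length at most `δ` and are empty unless `‖x‖ < R + ‖e‖`.
  set T : Set (ℝ × E) := {z | z.2 + z.1 • e ∈ B} with hT
  have hTm : MeasurableSet T := by
    have : Continuous fun z : ℝ × E => z.2 + z.1 • e := by fun_prop
    exact this.measurable hBm
  set lam := (volume : Measure ℝ).restrict (Set.Icc 0 1) with hlam
  have h1 : (lam.prod μ) T = μ B := by
    rw [Measure.prod_apply hTm]
    have : ∀ t : ℝ, μ (Prod.mk t ⁻¹' T) = μ B := fun t => by
      have : Prod.mk t ⁻¹' T = (fun x => x + t • e) ⁻¹' B := rfl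
      rw [this, measure_preimage_add_right]
    simp [this, hlam]
  have h2 : (lam.prod μ) T ≤ δ * μ (Metric.ball 0 (R + ‖e‖)) := by
    rw [Measure.prod_apply_symm hTm, ← setLIntegral_const,
      ← lintegral_indicator measurableSet_ball]
    refine lintegral_mono fun x => ?_
    by_cases hx : x ∈ Metric.ball (0 : E) (R + ‖e‖)
    · rw [Set.indicator_of_mem hx]
      refine (Measure.restrict_apply_le _ _).trans ((measure_mono ?_).trans (h x))
      exact fun t ht => ht.1
    · rw [Set.indicator_of_notMem hx, nonpos_iff_eq_zero, hlam,
        Measure.restrict_apply (hTm.preimage (by fun_prop))]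
      convert measure_empty (μ := (volume : Measure ℝ))
      refine Set.eq_empty_of_forall_notMem fun t ⟨ht, ht01⟩ => hx ?_
      have h3 : x + t • e ∈ Metric.ball (0 : E) R := ht.2
      rw [mem_ball_zero_iff] at h3 ⊢
      have h4 : ‖t • e‖ ≤ ‖e‖ := by
        rw [norm_smul, Real.norm_of_nonneg ht01.1]
        exact mul_le_of_le_one_left (norm_nonneg _) ht01.2
      have h5 : ‖x‖ ≤ ‖x + t • e‖ + ‖t • e‖ := by
        simpa using norm_sub_le (x + t • e) (t • e)
      linarith
  rwa [h1] at h2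

end NullSets

/-! ### Small values of determinants along lines -/

section DetBall

variable {d : ℕ}

theorem pow_card_le_norm_multiset_prod {s : Multiset ℂ} {η : ℝ} (hη : 0 ≤ η)
    (h : ∀ z ∈ s, η ≤ ‖z‖) : η ^ s.card ≤ ‖s.prod‖ := by
  induction s using Multiset.induction_on with
  | empty => simp
  | cons a s ih =>
    rw [Multiset.card_cons, Multiset.prod_cons, norm_mul, pow_succ, mul_comm]
    exact mul_le_mul (h a (Multiset.mem_cons_self a s))
      (ih fun z hz => h z (Multiset.mem_cons_of_mem hz)) (by positivity) (norm_nonneg _)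

/-- The determinant is the product of `t - z` over the `d` eigenvalues `z`. If it is small, `t` is
within `η` of some `z.re`, that is, in one of at most `d` intervals of length `2 η`. -/
theorem volume_norm_det_scalar_sub_lt_le (B : Matrix (Fin d) (Fin d) ℂ) {η : ℝ} (hη : 0 ≤ η) :
    volume {t : ℝ | ‖(Matrix.scalar (Fin d) (t : ℂ) - B).det‖ < η ^ d} ≤
      ENNReal.ofReal (d * (2 * η)) := by
  classical
  have hcard : B.charpoly.roots.card = d := by
    rw [← (IsAlgClosed.splits B.charpoly).natDegree_eq_card_roots, Matrix.charpoly_natDegree_eq_dim,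
      Fintype.card_fin]
  have hsub : {t : ℝ | ‖(Matrix.scalar (Fin d) (t : ℂ) - B).det‖ < η ^ d} ⊆
      ⋃ z ∈ B.charpoly.roots.toFinset, Metric.ball z.re η := by
    intro t ht
    by_contra hcon
    simp only [Set.mem_iUnion, not_exists, Multiset.mem_toFinset, Metric.mem_ball, not_lt] at hcon
    refine (show ¬ ‖(Matrix.scalar (Fin d) (t : ℂ) - B).det‖ < η ^ d from not_lt.2 ?_) ht
    rw [← Matrix.eval_charpoly, (IsAlgClosed.splits B.charpoly).eval_eq_prod_roots_of_monic
      B.charpoly_monic]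
    have := pow_card_le_norm_multiset_prod (s := B.charpoly.roots.map ((t : ℂ) - ·)) hη ?_
    · rwa [Multiset.card_map, hcard] at this
    · intro w hw
      obtain ⟨z, hz, rfl⟩ := Multiset.mem_map.1 hw
      refine (hcon z hz).trans ?_
      rw [Real.dist_eq]
      simpa using Complex.abs_re_le_norm ((t : ℂ) - z)
  refine (measure_mono hsub).trans ((measure_biUnion_finset_le _ _).trans ?_)
  simp only [Real.volume_ball, Finset.sum_const]
  rw [← ENNReal.ofReal_nsmul, nsmul_eq_mul]
  refine ENNReal.ofReal_le_ofReal (mul_le_mul_of_nonneg_right ?_ (by positivity))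
  exact_mod_cast (Multiset.toFinset_card_le _).trans hcard.le

/-- Factoring out `D` reduces this to the characteristic polynomial of `-(D⁻¹ * G)`. -/
theorem volume_norm_det_add_smul_lt_le (G D : Matrix (Fin d) (Fin d) ℂ) (hD : 1 / 2 ≤ ‖D.det‖)
    {η : ℝ} (hη : 0 ≤ η) :
    volume {t : ℝ | ‖(G + (t : ℂ) • D).det‖ < 1 / 2 * η ^ d} ≤ ENNReal.ofReal (d * (2 * η)) := by
  have hu : IsUnit D.det := by
    rw [isUnit_iff_ne_zero]
    intro h
    rw [h, norm_zero] at hD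
    norm_num at hD
  refine (measure_mono ?_).trans (volume_norm_det_scalar_sub_lt_le (-(D⁻¹ * G)) hη)
  intro t ht
  have h1 : G + (t : ℂ) • D = D * (Matrix.scalar (Fin d) (t : ℂ) - -(D⁻¹ * G)) := by
    rw [sub_neg_eq_add, Matrix.mul_add, ← Matrix.mul_assoc, Matrix.mul_nonsing_inv _ hu,
      Matrix.one_mul, Matrix.scalar_apply, ← Matrix.smul_one_eq_diagonal, Matrix.mul_smul,
      Matrix.mul_one, add_comm]
  rw [Set.mem_ofPred_eq, h1, Matrix.det_mul, norm_mul] at ht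
  rw [Set.mem_ofPred_eq]
  by_contra hcon
  rw [not_lt] at hcon
  exact absurd ht (not_lt.2 (mul_le_mul hD hcon (by positivity) (norm_nonneg _)))

/-- Matrices close to the identity have determinants bounded away from zero. -/
theorem exists_norm_det_ge_of_frob_le (d : ℕ) : ∃ ε > 0, ∀ D : Matrix (Fin d) (Fin d) ℂ,
    frob (1 - D) ≤ ε → 1 / 2 ≤ ‖D.det‖ := by
  have hc : Continuous fun D : Fin d → Fin d → ℂ => ‖(Matrix.of D).det‖ := by
    have : Continuous fun D : Fin d → Fin d → ℂ => (Matrix.of D).det := by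
      refine Continuous.matrix_det (continuous_matrix fun a b => ?_)
      simp only [Matrix.of_apply]
      fun_prop
    exact this.norm
  obtain ⟨δ, hδ, h⟩ := Metric.continuous_iff.1 hc (1 : Matrix (Fin d) (Fin d) ℂ) (1 / 2)
    (by norm_num)
  refine ⟨δ / 2, by positivity, fun D hD => ?_⟩
  have h1 := h D ((dist_pi_lt_iff hδ).2 fun a => (dist_pi_lt_iff hδ).2 fun b => ?_)
  · rw [Real.dist_eq] at h1
    have h2 : ‖(Matrix.of (1 : Matrix (Fin d) (Fin d) ℂ)).det‖ = 1 := by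
      change ‖(1 : Matrix (Fin d) (Fin d) ℂ).det‖ = 1
      simp
    have h3 := (abs_lt.1 h1).1
    change -(1 / 2) < ‖D.det‖ - _ at h3
    rw [h2] at h3
    linarith
  · have := (norm_apply_le_frob (1 - D) a b).trans hD
    rw [dist_comm, dist_eq_norm]
    exact this.trans_lt (by linarith)

end DetBall

/-! ### Distinctness of codewords -/

section Distinct

variable {r : Type*} [Fintype r] {p : ℕ}

/-- A subspace has at most one basis with an identity block in the rows `e`. -/
theorem eq_of_proj_eq {X Y F G : Matrix r (Fin p) ℂ} {C D : Matrix (Fin p) (Fin p) ℂ}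
    {e : Fin p → r} (hX : X.submatrix e id = 1) (hY : Y.submatrix e id = 1)
    (hG : TruncatedUnitary G) (hC : C.det ≠ 0) (hXF : X = F * C) (hYG : Y = G * D)
    (h : F * Fᴴ = G * Gᴴ) : X = Y := by
  have h1 : Y = X * (C⁻¹ * Fᴴ * Y) := by
    have h2 : G * Gᴴ * Y = Y := by
      rw [hYG, ← Matrix.mul_assoc, hG.proj_mul_self]
    calc Y = F * Fᴴ * Y := by rw [h, h2]
      _ = F * (C * C⁻¹) * Fᴴ * Y := by
          rw [Matrix.mul_nonsing_inv _ (isUnit_iff_ne_zero.2 hC), Matrix.mul_one]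
      _ = _ := by rw [hXF]; simp only [Matrix.mul_assoc]
  have h3 : Y.submatrix e id = X.submatrix e id * (C⁻¹ * Fᴴ * Y) :=
    congrArg (fun Z => Matrix.submatrix Z e id) h1
  rw [hX, hY, Matrix.one_mul] at h3
  rw [h1, ← h3, Matrix.mul_one]

/-- The Grassmann manifold is not covered by finitely many subspaces. -/
theorem exists_chordalDist_ne_zero (hp : 0 < p) (hpr : p < Fintype.card r) {m : ℕ}
    (code : Fin m → Matrix r (Fin p) ℂ) :
    ∃ X : Matrix r (Fin p) ℂ, TruncatedUnitary X ∧ ∀ a, chordalDist (code a) X ≠ 0 := by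
  classical
  obtain ⟨e⟩ := Function.Embedding.nonempty_of_card_le (α := Fin p) (β := r)
    (by simpa using hpr.le)
  obtain ⟨b, hb⟩ : ∃ b, b ∉ Set.range e := by
    by_contra! hcon
    have := Fintype.card_le_of_surjective e fun b => hcon b
    rw [Fintype.card_fin] at this
    omega
  set i₀ : Fin p := ⟨0, hp⟩
  -- Infinitely many subspaces: a coordinate frame with entry `t` added in a row `b` outside it. If
  -- finitely many codewords matched them all, two would coincide, against `eq_of_proj_eq`.
  set Y : ℕ → Matrix r (Fin p) ℂ := fun t =>
    Matrix.of fun a i => (if a = e i then 1 else 0) + if a = b ∧ i = i₀ then (t : ℂ) else 0 with hY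
  have hYe : ∀ t, (Y t).submatrix e id = 1 := fun t => by
    ext i j
    have : e i ≠ b := fun h => hb ⟨i, h⟩
    simp [hY, Matrix.one_apply, this]
  have hYdet : ∀ t, ((Y t)ᴴ * Y t).det ≠ 0 := fun t => by
    refine det_conjTranspose_mul_self_ne_zero (le_antisymm
      ((Matrix.rank_le_card_width _).trans_eq (Fintype.card_fin p)) ?_)
    have h1 : (Y t).submatrix e id = (1 : Matrix r r ℂ).submatrix e id * Y t := by
      conv_lhs => rw [← Matrix.one_mul (Y t)]
      rfl
    have h2 : ((Y t).submatrix e id).rank = p := by rw [hYe, Matrix.rank_one, Fintype.card_fin]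
    refine h2.symm.trans_le ?_
    rw [h1]
    exact Matrix.rank_mul_le_right _ _
  choose F C hF hC hFC using fun t => exists_truncatedUnitary_mul (hYdet t)
  by_contra! hcon
  choose a ha using fun t => hcon (F t) (hF t)
  obtain ⟨s, t, hst, h⟩ := Finite.exists_ne_map_eq_of_infinite a
  have hs := chordalDist_eq_zero.1 (ha s)
  have ht := chordalDist_eq_zero.1 (ha t)
  rw [h, ht] at hs
  have hYst : Y s = Y t := eq_of_proj_eq (hYe s) (hYe t) (hF t) (hC s) (hFC s) (hFC t) hs.symm
  have h3 := congrFun (congrFun hYst b) i₀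
  have hbe : b ≠ e i₀ := fun h => hb ⟨i₀, h.symm⟩
  simp only [hY, Matrix.of_apply, hbe, if_false, and_self, if_true, zero_add] at h3
  exact hst (by exact_mod_cast h3)

/-- A repeated subspace forces `δ ≤ 0`, so the codewords would exhaust the Grassmannian. -/
theorem IsSubspacePacking.chordalDist_ne_zero (hp : 0 < p) (hpr : p < Fintype.card r) {m : ℕ}
    {code : Fin m → Matrix r (Fin p) ℂ} (h : IsSubspacePacking code) {a b : Fin m} (hab : a ≠ b) :
    chordalDist (code a) (code b) ≠ 0 := by
  intro h0
  obtain ⟨-, δ, hδ, hcov⟩ := h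
  obtain ⟨X, hX, hne⟩ := exists_chordalDist_ne_zero hp hpr code
  obtain ⟨c, hc⟩ := hcov X hX
  have := hδ a b hab
  exact hne c (le_antisymm (by linarith) (chordalDist_nonneg _ _))

end Distinct

/-! ### Polynomial criterion for nearest codewords -/

section Score

variable {r : Type*} [Fintype r] {p : ℕ}

/-- The pseudoinverse of a matrix of full column rank, multiplied by its Gram determinant. -/
def pinvNum (S : Matrix r (Fin p) ℂ) : Matrix (Fin p) r ℂ :=
  (Sᴴ * S).adjugate * Sᴴ

/-- A polynomial in the entries of `S`; for a fixed `S` of full column rank it is a decreasing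
function of the chordal distance between the column spaces of `S` and `A`. -/
def proximity (S A : Matrix r (Fin p) ℂ) : ℝ :=
  (Matrix.trace (S * pinvNum S * (A * Aᴴ))).re

variable {F A B : Matrix r (Fin p) ℂ} {C : Matrix (Fin p) (Fin p) ℂ}

theorem TruncatedUnitary.gram_mul (hF : TruncatedUnitary F) (C : Matrix (Fin p) (Fin p) ℂ) :
    (F * C)ᴴ * (F * C) = Cᴴ * C := by
  rw [Matrix.conjTranspose_mul, Matrix.mul_assoc, ← Matrix.mul_assoc Fᴴ, show Fᴴ * F = 1 from hF,
    Matrix.one_mul]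

theorem det_conjTranspose_mul_self_eq (C : Matrix (Fin p) (Fin p) ℂ) :
    (Cᴴ * C).det = ((‖C.det‖ ^ 2 : ℝ) : ℂ) := by
  rw [Matrix.det_mul, Matrix.det_conjTranspose, Complex.star_def, mul_comm, Complex.mul_conj,
    Complex.normSq_eq_norm_sq]

/-- Replaces `C⁻¹ Fᴴ`, which depends on the factorization, by a polynomial in the stack and its
conjugate. -/
theorem TruncatedUnitary.pinvNum_mul (hF : TruncatedUnitary F) (hC : C.det ≠ 0) :
    pinvNum (F * C) = ((‖C.det‖ ^ 2 : ℝ) : ℂ) • (C⁻¹ * Fᴴ) := by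
  rw [pinvNum, hF.gram_mul, ← det_conjTranspose_mul_self_eq]
  calc (Cᴴ * C).adjugate * (F * C)ᴴ =
      (Cᴴ * C).adjugate * (Cᴴ * (C * C⁻¹)) * Fᴴ := by
        rw [Matrix.mul_nonsing_inv _ (isUnit_iff_ne_zero.2 hC), Matrix.mul_one,
          Matrix.conjTranspose_mul, Matrix.mul_assoc]
    _ = ((Cᴴ * C).adjugate * (Cᴴ * C)) * (C⁻¹ * Fᴴ) := by simp only [Matrix.mul_assoc]
    _ = _ := by rw [Matrix.adjugate_mul, Matrix.smul_mul, Matrix.one_mul]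

/-- The prefactor does not depend on the codeword, so ranking by `proximity` is ranking by distance,
whatever the factorization. -/
theorem TruncatedUnitary.proximity_mul (hF : TruncatedUnitary F) (hC : C.det ≠ 0)
    (hA : TruncatedUnitary A) :
    proximity (F * C) A = ‖C.det‖ ^ 2 * (p - chordalDist A F ^ 2) := by
  have h1 : F * C * pinvNum (F * C) = ((‖C.det‖ ^ 2 : ℝ) : ℂ) • (F * Fᴴ) := by
    rw [hF.pinvNum_mul hC, Matrix.mul_smul, Matrix.mul_assoc, ← Matrix.mul_assoc C,
      Matrix.mul_nonsing_inv _ (isUnit_iff_ne_zero.2 hC), Matrix.one_mul]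
  rw [proximity, h1, Matrix.smul_mul, Matrix.trace_smul, smul_eq_mul, Complex.re_ofReal_mul,
    chordalDist_comm, hF.chordalDist_sq_eq_trace hA]
  ring

theorem TruncatedUnitary.proximity_le_iff (hF : TruncatedUnitary F) (hC : C.det ≠ 0)
    (hA : TruncatedUnitary A) (hB : TruncatedUnitary B) :
    proximity (F * C) A ≤ proximity (F * C) B ↔ chordalDist B F ≤ chordalDist A F := by
  have hpos : 0 < ‖C.det‖ ^ 2 := by positivity
  rw [hF.proximity_mul hC hA, hF.proximity_mul hC hB, mul_le_mul_iff_right₀ hpos,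
    sub_le_sub_iff_left, sq_le_sq₀ (chordalDist_nonneg _ _) (chordalDist_nonneg _ _)]

theorem continuous_pinvNum : Continuous (pinvNum : Matrix r (Fin p) ℂ → Matrix (Fin p) r ℂ) := by
  unfold pinvNum
  have h : Continuous fun S : Matrix r (Fin p) ℂ => Sᴴ * S := by fun_prop
  exact h.matrix_adjugate.matrix_mul continuous_id.matrix_conjTranspose

theorem continuous_proximity (A : Matrix r (Fin p) ℂ) :
    Continuous fun S : Matrix r (Fin p) ℂ => proximity S A := by
  unfold proximity
  exact Complex.continuous_re.comp
    ((continuous_id.matrix_mul continuous_pinvNum).matrix_mul continuous_const).matrix_trace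

end Score

/-! ### Generic channels -/

section Analytic

variable {r s u : Type*}

/-- Matrix-valued functions with real analytic entries. -/
def EntrywiseAnalytic (X : ℝ → Matrix r s ℂ) : Prop :=
  ∀ a b, AnalyticOnNhd ℝ (fun t => X t a b) Set.univ

theorem EntrywiseAnalytic.const (X : Matrix r s ℂ) : EntrywiseAnalytic fun _ => X :=
  fun _ _ => analyticOnNhd_const

theorem EntrywiseAnalytic.mul [Fintype s] {X : ℝ → Matrix r s ℂ} {Y : ℝ → Matrix s u ℂ}
    (hX : EntrywiseAnalytic X) (hY : EntrywiseAnalytic Y) :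
    EntrywiseAnalytic fun t => X t * Y t := fun a b => by
  simp only [Matrix.mul_apply]
  exact Finset.analyticOnNhd_fun_sum _ fun c _ => (hX a c).mul (hY c b)

/-- Conjugation is linear over the reals only, which is why analyticity is taken along real lines.
-/
theorem EntrywiseAnalytic.conjTranspose {X : ℝ → Matrix r s ℂ} (hX : EntrywiseAnalytic X) :
    EntrywiseAnalytic fun t => (X t)ᴴ := fun a b => by
  simp only [Matrix.conjTranspose_apply]
  exact (Complex.conjCLE.toContinuousLinearMap.analyticOnNhd Set.univ).comp (hX b a)
    (Set.mapsTo_univ _ _)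

theorem EntrywiseAnalytic.trace [Fintype r] {X : ℝ → Matrix r r ℂ} (hX : EntrywiseAnalytic X) :
    AnalyticOnNhd ℝ (fun t => (X t).trace) Set.univ := by
  simp only [Matrix.trace, Matrix.diag]
  exact Finset.analyticOnNhd_fun_sum _ fun c _ => hX c c

theorem EntrywiseAnalytic.det [Fintype r] [DecidableEq r] {X : ℝ → Matrix r r ℂ}
    (hX : EntrywiseAnalytic X) : AnalyticOnNhd ℝ (fun t => (X t).det) Set.univ := by
  simp only [Matrix.det_apply']
  exact Finset.analyticOnNhd_fun_sum _ fun c _ =>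
    analyticOnNhd_const.mul (Finset.analyticOnNhd_fun_prod _ fun a _ => hX _ a)

theorem EntrywiseAnalytic.adjugate [Fintype r] [DecidableEq r] {X : ℝ → Matrix r r ℂ}
    (hX : EntrywiseAnalytic X) : EntrywiseAnalytic fun t => (X t).adjugate := fun a b => by
  simp only [Matrix.adjugate_apply]
  refine EntrywiseAnalytic.det fun i j => ?_
  by_cases hi : i = b
  · subst hi
    simp only [Matrix.updateRow_self]
    exact analyticOnNhd_const
  · simp only [Matrix.updateRow_ne hi]
    exact hX i j

theorem EntrywiseAnalytic.pinvNum [Fintype r] {p : ℕ} {X : ℝ → Matrix r (Fin p) ℂ}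
    (hX : EntrywiseAnalytic X) : EntrywiseAnalytic fun t => pinvNum (X t) :=
  (hX.conjTranspose.mul hX).adjugate.mul hX.conjTranspose

theorem EntrywiseAnalytic.proximity [Fintype r] {p : ℕ} {X : ℝ → Matrix r (Fin p) ℂ}
    (hX : EntrywiseAnalytic X) (A : Matrix r (Fin p) ℂ) :
    AnalyticOnNhd ℝ (fun t => proximity (X t) A) Set.univ :=
  (Complex.reCLM.analyticOnNhd Set.univ).comp
    ((hX.mul hX.pinvNum).mul (EntrywiseAnalytic.const (A * Aᴴ))).trace (Set.mapsTo_univ _ _)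

end Analytic

/-! ### Full-rank stacks and absence of quantization ties for almost every channel. -/

section Generic

variable {K N M d : ℕ}

theorem continuous_stack (j : Fin K) : Continuous fun H : Channel K N M => H.stack j := by
  refine continuous_matrix fun a b => ?_
  simp only [Channel.stack, Matrix.of_apply]
  fun_prop

theorem entrywiseAnalytic_stack (j : Fin K) (H X : Channel K N M) :
    EntrywiseAnalytic fun t : ℝ => (H + t • X).stack j := fun a b => by
  have : AnalyticOnNhd ℝ (fun t : ℝ => H a.2 j a.1 b + t • X a.2 j a.1 b) Set.univ :=
    analyticOnNhd_const.add (analyticOnNhd_id.smul analyticOnNhd_const)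
  exact this

theorem exists_stack_eq (j : Fin K) (A : Matrix (CrossRows N j) (Fin M) ℂ) :
    ∃ H : Channel K N M, H.stack j = A := by
  refine ⟨fun i _ n m => if h : i ≠ j then A (n, ⟨i, h⟩) m else 0, ?_⟩
  ext ⟨n, i⟩ m
  simp only [Channel.stack, Matrix.of_apply]
  rw [dif_pos i.2]

theorem ae_det_gram_ne_zero (hM : M ≤ (K - 1) * N) (j : Fin K) :
    ∀ᵐ H : Channel K N M, ((H.stack j)ᴴ * H.stack j).det ≠ 0 := by
  obtain ⟨A, hA⟩ := exists_truncatedUnitary (r := CrossRows N j) (p := M)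
    (by rwa [card_crossRows])
  obtain ⟨H₀, hH₀⟩ := exists_stack_eq j A
  refine ae_ne_zero_of_analytic_lines volume (x₀ := H₀) ?_ ?_ fun X => ?_
  · have h := continuous_stack (N := N) (M := M) j
    exact (h.matrix_conjTranspose.matrix_mul h).matrix_det
  · rw [hH₀, show Aᴴ * A = 1 from hA, Matrix.det_one]
    exact one_ne_zero
  · have h := entrywiseAnalytic_stack j H₀ X
    exact (h.conjTranspose.mul h).det

/-- At a channel whose stack is `A` itself the difference is `chordalDist A B ^ 2`, so this real
analytic function is not identically zero. -/
theorem ae_proximity_ne (j : Fin K) {A B : Matrix (CrossRows N j) (Fin M) ℂ}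
    (hA : TruncatedUnitary A) (hB : TruncatedUnitary B) (hAB : chordalDist A B ≠ 0) :
    ∀ᵐ H : Channel K N M, proximity (H.stack j) A ≠ proximity (H.stack j) B := by
  obtain ⟨H₀, hH₀⟩ := exists_stack_eq j A
  have h := ae_ne_zero_of_analytic_lines (volume : Measure (Channel K N M)) (x₀ := H₀)
    (f := fun H => proximity (H.stack j) A - proximity (H.stack j) B) ?_ ?_ fun X => ?_
  · filter_upwards [h] with H hH
    exact sub_ne_zero.1 hH
  · exact ((continuous_proximity A).comp (continuous_stack j)).sub
      ((continuous_proximity B).comp (continuous_stack j))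
  · have hdet : (1 : Matrix (Fin M) (Fin M) ℂ).det ≠ 0 := by simp
    have h1 := hA.proximity_mul hdet hA
    have h2 := hA.proximity_mul hdet hB
    rw [Matrix.mul_one] at h1 h2
    have h3 : chordalDist A A = 0 := chordalDist_eq_zero.2 rfl
    rw [hH₀, h1, h2, h3, chordalDist_comm B A]
    simpa using hAB
  · have h := entrywiseAnalytic_stack j H₀ X
    exact (h.proximity A).sub (h.proximity B)

/-- Channels for which all quantization steps of the base stations are unambiguous. -/
def Scheme.Generic (σ : Scheme K N M d) (H : Channel K N M) : Prop :=
  (∀ j, ((H.stack j)ᴴ * H.stack j).det ≠ 0) ∧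
    ∀ j n (a b : Fin (2 ^ n)), a ≠ b →
      proximity (H.stack j) ((σ.bsQuant j).code n a) ≠
        proximity (H.stack j) ((σ.bsQuant j).code n b)

theorem Scheme.ae_generic (σ : Scheme K N M d) (hM0 : 0 < M) (hM : M < (K - 1) * N) :
    ∀ᵐ H : Channel K N M, σ.Generic H := by
  refine (ae_all_iff.2 fun j => ae_det_gram_ne_zero hM.le j).and ?_
  refine ae_all_iff.2 fun j => ae_all_iff.2 fun n => ae_all_iff.2 fun a => ae_all_iff.2 fun b => ?_
  by_cases hab : a = b
  · exact Eventually.of_forall fun H h => absurd hab h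
  · filter_upwards [ae_proximity_ne j (((σ.bsQuant j).packing n).1 a)
      (((σ.bsQuant j).packing n).1 b) (((σ.bsQuant j).packing n).chordalDist_ne_zero hM0
        (by rwa [card_crossRows]) hab)] with H hH _
    exact hH

theorem det_ne_zero_of_det_gram_ne_zero {r : Type*} [Fintype r] {F : Matrix r (Fin M) ℂ}
    {C : Matrix (Fin M) (Fin M) ℂ} (hF : TruncatedUnitary F)
    (h : ((F * C)ᴴ * (F * C)).det ≠ 0) : C.det ≠ 0 := by
  rw [hF.gram_mul, Matrix.det_mul] at h
  exact right_ne_zero_of_mul h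

end Generic

/-! ### Non-degeneracy of the direct links -/

section DirectLinks

variable {K N M d : ℕ}

/-- Fine codebooks have a codeword close to any given subspace. -/
theorem exists_forall_exists_chordalDist_le (r : Type*) [Fintype r] (p : ℕ) {ε : ℝ} (hε : 0 < ε) :
    ∃ n₀ : ℕ, ∀ n, n₀ ≤ n → ∀ (q : Quantizer r p) (X : Matrix r (Fin p) ℂ), TruncatedUnitary X →
      ∃ a, chordalDist (q.code n a) X ≤ ε := by
  set L : ℝ := (1 + p) * (Fintype.card r * p * 2) * Real.sqrt p with hL
  have hL0 : 0 ≤ L := by positivity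
  obtain ⟨k, hk⟩ := exists_nat_gt (L / ε)
  have hk0 : (0 : ℝ) < k := (div_nonneg hL0 hε.le).trans_lt hk
  -- A wasteful choice of `n₀`, sufficient because `n < 2 ^ n`.
  refine ⟨Fintype.card (Fin p → r) * (2 * k + 1) ^ grassmannDim (Fintype.card r) p,
    fun n hn q X hX => ?_⟩
  obtain ⟨a, ha⟩ := (q.packing n).exists_chordalDist_le (k := k) (by exact_mod_cast hk0)
    (hn.trans_lt Nat.lt_two_pow_self) hX
  refine ⟨a, ha.trans ?_⟩
  rw [div_le_iff₀ hk0]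
  rw [div_lt_iff₀ hε] at hk
  linarith

/-- For most direct channels, the signal received over nearly ideal filters and precoders does not
degenerate. -/
theorem volume_det_lt_inter_ball_le {r : Type*} [Fintype r] {U : Matrix (Fin N) (Fin d) ℂ}
    {Vh : Matrix (Fin M) (Fin d) ℂ} {F Fh : Matrix r (Fin M) ℂ} {C : Matrix (Fin M) (Fin M) ℂ}
    (hU : TruncatedUnitary U) (hVh : TruncatedUnitary Vh) (hF : TruncatedUnitary F)
    (hFh : TruncatedUnitary Fh) (hC : C.det ≠ 0) {ε : ℝ}
    (hε : ∀ D : Matrix (Fin d) (Fin d) ℂ, frob (1 - D) ≤ ε → 1 / 2 ≤ ‖D.det‖)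
    (hdist : d * M * Real.sqrt 2 * chordalDist Fh F ≤ ε) (A : Matrix (Fin N) (Fin M) ℂ)
    {η : ℝ} (hη : 0 ≤ η) (R : ℝ) :
    volume ({X : Fin N → Fin M → ℂ |
        ‖(Uᴴ * (A + Matrix.of X) * (C⁻¹ * Fᴴ * Fh * Vh)).det‖ < 1 / 2 * η ^ d} ∩
          Metric.ball 0 R) ≤
      ENNReal.ofReal (d * (2 * η)) *
        volume (Metric.ball (0 : Fin N → Fin M → ℂ) (R + d * M * frob C)) := by
  -- Chosen so that moving the direct link along `E` moves the effective channel along `D = V̂ᴴ F̂ᴴ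
  -- F Fᴴ F̂ V̂`, which is near the identity when `F̂` is near `F`. Its size is bounded
  -- independently of the codewords.
  set E : Matrix (Fin N) (Fin M) ℂ := U * (Vhᴴ * (Fᴴ * Fh)ᴴ * C) with hE
  have hsd : Real.sqrt d * Real.sqrt d = d := Real.mul_self_sqrt (Nat.cast_nonneg d)
  have hsM : Real.sqrt M * Real.sqrt M = M := Real.mul_self_sqrt (Nat.cast_nonneg M)
  set e : Fin N → Fin M → ℂ := fun a b => E a b with he
  have hEnorm : ‖e‖ ≤ d * M * frob C := by
    have h1 : frob E ≤ d * M * frob C := by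
      have h2 : frob (Fᴴ * Fh)ᴴ ≤ M := by
        rw [frob_conjTranspose, ← hsM]
        refine (frob_mul_le _ _).trans_eq ?_
        rw [frob_conjTranspose, hF.frob_eq, hFh.frob_eq]
      calc frob E ≤ frob U * frob (Vhᴴ * (Fᴴ * Fh)ᴴ * C) := frob_mul_le _ _
        _ ≤ frob U * (frob Vhᴴ * frob (Fᴴ * Fh)ᴴ * frob C) :=
            mul_le_mul_of_nonneg_left (frob_mul₃_le _ _ _) (frob_nonneg _)
        _ = d * frob (Fᴴ * Fh)ᴴ * frob C := by
            rw [frob_conjTranspose Vh, hU.frob_eq, hVh.frob_eq]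
            linear_combination (frob (Fᴴ * Fh)ᴴ * frob C) * hsd
        _ ≤ _ := by
            have := frob_nonneg C
            gcongr
    have h0 : 0 ≤ d * M * frob C := (frob_nonneg _).trans h1
    exact (pi_norm_le_iff_of_nonneg h0).2 fun a => (pi_norm_le_iff_of_nonneg h0).2 fun b =>
      (norm_apply_le_frob E a b).trans h1
  set D : Matrix (Fin d) (Fin d) ℂ := Uᴴ * E * (C⁻¹ * Fᴴ * Fh * Vh) with hDdef
  have hD1 : D = Vhᴴ * (Fhᴴ * (F * Fᴴ) * Fh) * Vh := by
    calc D = (Uᴴ * U) * Vhᴴ * (Fᴴ * Fh)ᴴ * (C * C⁻¹) * Fᴴ * Fh * Vh := by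
          rw [hDdef, hE]; simp only [Matrix.mul_assoc]
      _ = _ := by
          rw [show Uᴴ * U = 1 from hU, Matrix.mul_nonsing_inv _ (isUnit_iff_ne_zero.2 hC),
            Matrix.one_mul, Matrix.mul_one, Matrix.conjTranspose_mul,
            Matrix.conjTranspose_conjTranspose]
          simp only [Matrix.mul_assoc]
  have hD2 : 1 - D = Vhᴴ * (Fhᴴ * (Fh * Fhᴴ - F * Fᴴ) * Fh) * Vh := by
    have h1 : Fhᴴ * (Fh * Fhᴴ) * Fh = 1 := by
      rw [← Matrix.mul_assoc, show Fhᴴ * Fh = 1 from hFh, Matrix.one_mul,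
        show Fhᴴ * Fh = 1 from hFh]
    rw [hD1, Matrix.mul_sub, Matrix.sub_mul, h1, Matrix.mul_sub, Matrix.sub_mul, Matrix.mul_one,
      show Vhᴴ * Vh = 1 from hVh]
  have hDdet : 1 / 2 ≤ ‖D.det‖ := by
    refine hε D (le_trans ?_ hdist)
    rw [hD2]
    have h1 := frob_mul₃_le Fhᴴ (Fh * Fhᴴ - F * Fᴴ) Fh
    calc _ ≤ frob Vhᴴ * frob (Fhᴴ * (Fh * Fhᴴ - F * Fᴴ) * Fh) * frob Vh := frob_mul₃_le _ _ _
      _ ≤ frob Vhᴴ * (frob Fhᴴ * frob (Fh * Fhᴴ - F * Fᴴ) * frob Fh) * frob Vh := by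
          have := frob_nonneg Vh
          have := frob_nonneg Vhᴴ
          gcongr
      _ = d * M * Real.sqrt 2 * chordalDist Fh F := by
          rw [frob_conjTranspose, frob_conjTranspose, hVh.frob_eq, hFh.frob_eq,
            frob_sub_eq_chordalDist]
          linear_combination (Real.sqrt M * Real.sqrt M * Real.sqrt 2 * chordalDist Fh F) * hsd +
            (d * Real.sqrt 2 * chordalDist Fh F) * hsM
  have hZ : MeasurableSet {X : Fin N → Fin M → ℂ |
      ‖(Uᴴ * (A + Matrix.of X) * (C⁻¹ * Fᴴ * Fh * Vh)).det‖ < 1 / 2 * η ^ d} := by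
    have h1 : Continuous fun X : Fin N → Fin M → ℂ => A + Matrix.of X :=
      continuous_matrix fun a b => by
        simp only [Matrix.add_apply, Matrix.of_apply]
        fun_prop
    have h2 : Continuous fun X : Fin N → Fin M → ℂ =>
        ‖(Uᴴ * (A + Matrix.of X) * (C⁻¹ * Fᴴ * Fh * Vh)).det‖ :=
      ((continuous_const.matrix_mul h1).matrix_mul continuous_const).matrix_det.norm
    exact (isOpen_lt h2 continuous_const).measurableSet
  refine (measure_inter_ball_le_of_segments volume hZ (e := e)
    (fun X => ?_) R).trans
    (mul_le_mul_right (measure_mono (Metric.ball_subset_ball (by linarith))) _)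
  refine le_trans (measure_mono fun t ht => ?_) (volume_norm_det_add_smul_lt_le
    (Uᴴ * (A + Matrix.of X) * (C⁻¹ * Fᴴ * Fh * Vh)) D hDdet hη)
  have h1 : A + Matrix.of (X + t • e) =
      (A + Matrix.of X) + (t : ℂ) • E := by
    ext a b
    simp only [Matrix.add_apply, Matrix.of_apply, Pi.add_apply, Pi.smul_apply, Matrix.smul_apply,
      Complex.real_smul, smul_eq_mul, he]
    ring
  have h2 : Uᴴ * (A + Matrix.of X) * (C⁻¹ * Fᴴ * Fh * Vh) + (t : ℂ) • D =
      Uᴴ * (A + Matrix.of (X + t • e)) * (C⁻¹ * Fᴴ * Fh * Vh) := by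
    rw [h1, hDdef, Matrix.mul_add Uᴴ (A + Matrix.of X),
      Matrix.add_mul (Uᴴ * (A + Matrix.of X)), Matrix.mul_smul, Matrix.smul_mul]
  change ‖(_ + (t : ℂ) • D).det‖ < _
  rw [h2]
  exact ht

/-- Tolerated degradation of the direct channel for given numbers of bits. -/
def tolerance (n m : ℕ) : ℝ :=
  1 / ((n + 1 : ℝ) ^ 2) * (1 / (m + 1 : ℝ) ^ 2)

theorem tolerance_pos (n m : ℕ) : 0 < tolerance n m := by
  unfold tolerance; positivity

/-- A channel with a single nonzero link, the direct link of user `i`. -/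
def directLink (i : Fin K) (X : Fin N → Fin M → ℂ) : Channel K N M :=
  fun i' j' n m => if i' = i ∧ j' = i then X n m else 0

theorem continuous_directLink (i : Fin K) :
    Continuous (directLink i : (Fin N → Fin M → ℂ) → Channel K N M) := by
  refine continuous_pi fun i' => continuous_pi fun j' => continuous_pi fun n =>
    continuous_pi fun m => ?_
  unfold directLink
  split_ifs <;> fun_prop

/-- Changing a direct link leaves the data sent by the base stations intact, hence also the filters
and precoders. -/
theorem stack_add_directLink (H : Channel K N M) (i : Fin K) (X : Fin N → Fin M → ℂ) (j : Fin K) :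
    (H + directLink i X).stack j = H.stack j := by
  ext a m
  have h : ¬ ((a.2 : Fin K) = i ∧ j = i) := fun h => a.2.2 (h.1.trans h.2.symm)
  simp [Channel.stack, directLink, h]

theorem mat_add_directLink (H : Channel K N M) (i : Fin K) (X : Fin N → Fin M → ℂ) :
    (H + directLink i X).mat i i = H.mat i i + Matrix.of X := by
  ext n m
  simp [Channel.mat, directLink]

/-! ### Degenerate channels and the Borel–Cantelli estimate. -/

namespace Scheme

variable (σ : Scheme K N M d)

/-- The reconstructed stacked channels for given indices of codewords. -/
def codewords (n : ℕ) (a : Fin K → Fin (2 ^ n)) (j : Fin K) : Matrix (CrossRows N j) (Fin M) ℂ :=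
  (σ.bsQuant j).code n (a j)

theorem truncatedUnitary_codewords (n : ℕ) (a : Fin K → Fin (2 ^ n)) (j : Fin K) :
    TruncatedUnitary (σ.codewords n a j) :=
  ((σ.bsQuant j).packing n).1 _

/-- The determinant of the effective direct channel of user `i`, as a polynomial in the channel,
for given codeword indices and number of bits of the central node. -/
def directGain (i : Fin K) (n m : ℕ) (a : Fin K → Fin (2 ^ n)) (H : Channel K N M) : ℂ :=
  ((σ.filters (σ.codewords n a) i)ᴴ * H.mat i i * (pinvNum (H.stack i) * σ.codewords n a i *
    (σ.cnQuant i).quantize m (σ.precoders (σ.codewords n a) i))).det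

/-- Channels in which the signal of user `i` degenerates. -/
def degenerate (i : Fin K) (n : ℕ) : Set (Channel K N M) :=
  ⋃ m, ⋃ a : Fin K → Fin (2 ^ n), {H | (∀ j b, proximity (H.stack j) ((σ.bsQuant j).code n b) ≤
      proximity (H.stack j) (σ.codewords n a j)) ∧
    ‖σ.directGain i n m a H‖ <
      ‖((H.stack i)ᴴ * H.stack i).det‖ ^ d * (1 / 2 * tolerance n m ^ d)}

theorem continuous_directGain (i : Fin K) (n m : ℕ) (a : Fin K → Fin (2 ^ n)) :
    Continuous (σ.directGain i n m a) := by
  have h1 : Continuous fun H : Channel K N M => H.mat i i := continuous_matrix fun a b => by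
    simp only [Channel.mat, Matrix.of_apply]
    fun_prop
  have h2 : Continuous fun H : Channel K N M => pinvNum (H.stack i) :=
    continuous_pinvNum.comp (continuous_stack i)
  exact ((continuous_const.matrix_mul h1).matrix_mul
    ((h2.matrix_mul continuous_const).matrix_mul continuous_const)).matrix_det

/-- The alignment rule and tie-breaking need not be measurable. For fixed codeword indices they
contribute constants, and only countably many continuous conditions on `H` remain. -/
theorem measurableSet_degenerate (i : Fin K) (n : ℕ) : MeasurableSet (σ.degenerate i n) := by
  refine MeasurableSet.iUnion fun m => MeasurableSet.iUnion fun a => ?_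
  have hp : ∀ j (A : Matrix (CrossRows N j) (Fin M) ℂ),
      Continuous fun H : Channel K N M => proximity (H.stack j) A := fun j A =>
    (continuous_proximity A).comp (continuous_stack j)
  have h1 : IsClosed {H : Channel K N M | ∀ j b, proximity (H.stack j)
      ((σ.bsQuant j).code n b) ≤ proximity (H.stack j) (σ.codewords n a j)} := by
    simp only [Set.ofPred_forall]
    exact isClosed_iInter fun j => isClosed_iInter fun b => isClosed_le (hp _ _) (hp _ _)
  have hs : Continuous fun H : Channel K N M => H.stack i := continuous_stack i
  have h2 : Continuous fun H : Channel K N M => ((H.stack i)ᴴ * H.stack i).det :=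
    (hs.matrix_conjTranspose.matrix_mul hs).matrix_det
  exact h1.measurableSet.inter (isOpen_lt (σ.continuous_directGain i n m a).norm
    ((h2.norm.pow d).mul continuous_const)).measurableSet

/-- Passing from `pinvNum` to `C⁻¹ Fᴴ` costs the Gram determinant, raised to the power `d` by the `d
× d` determinant; this explains that factor in `degenerate`. -/
theorem norm_directGain_lt_iff {i : Fin K} {n m : ℕ} {a : Fin K → Fin (2 ^ n)} {H : Channel K N M}
    {F : Matrix (CrossRows N i) (Fin M) ℂ} {C : Matrix (Fin M) (Fin M) ℂ}
    (hF : TruncatedUnitary F) (hC : C.det ≠ 0) (hFC : H.stack i = F * C) (x : ℝ) :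
    ‖σ.directGain i n m a H‖ < ‖((H.stack i)ᴴ * H.stack i).det‖ ^ d * x ↔
      ‖((σ.filters (σ.codewords n a) i)ᴴ * H.mat i i * (C⁻¹ * Fᴴ * σ.codewords n a i *
        (σ.cnQuant i).quantize m (σ.precoders (σ.codewords n a) i))).det‖ < x := by
  have hpos : 0 < ‖C.det‖ ^ 2 := by positivity
  have h1 : ‖(((‖C.det‖ ^ 2 : ℝ)) : ℂ)‖ = ‖C.det‖ ^ 2 := by
    rw [Complex.norm_real, Real.norm_of_nonneg hpos.le]
  rw [directGain, hFC, hF.gram_mul, det_conjTranspose_mul_self_eq, h1, hF.pinvNum_mul hC,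
    Matrix.smul_mul, Matrix.smul_mul, Matrix.mul_smul, Matrix.det_smul, Fintype.card_fin, norm_mul,
    norm_pow, h1]
  exact mul_lt_mul_iff_right₀ (pow_pos hpos d)

theorem ae_link_eventually_notMem_degenerate (i : Fin K) {H : Channel K N M} (hH : σ.Generic H) :
    ∀ᵐ X : Fin N → Fin M → ℂ, ∀ᶠ n in atTop, H + directLink i X ∉ σ.degenerate i n := by
  choose F C hF hC hFC using fun j => exists_truncatedUnitary_mul (hH.1 j)
  choose a ha using fun (n : ℕ) (j : Fin K) =>
    haveI : Nonempty (Fin (2 ^ n)) := ⟨⟨0, by positivity⟩⟩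
    Finite.exists_max fun b => proximity (H.stack j) ((σ.bsQuant j).code n b)
  obtain ⟨ε, hε0, hε⟩ := exists_norm_det_ge_of_frob_le d
  obtain ⟨n₀, hn₀⟩ := exists_forall_exists_chordalDist_le (CrossRows N i) M
    (ε := ε / (d * M * Real.sqrt 2 + 1)) (by positivity)
  have hdist : ∀ n, n₀ ≤ n →
      d * M * Real.sqrt 2 * chordalDist (σ.codewords n (a n) i) (F i) ≤ ε := by
    intro n hn
    obtain ⟨b, hb⟩ := hn₀ n hn (σ.bsQuant i) (F i) (hF i)
    have h1 := ha n i b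
    rw [hFC i, (hF i).proximity_le_iff (hC i) (((σ.bsQuant i).packing n).1 _)
      (((σ.bsQuant i).packing n).1 _)] at h1
    have h2 : chordalDist (σ.codewords n (a n) i) (F i) ≤ ε / (d * M * Real.sqrt 2 + 1) :=
      h1.trans hb
    have h3 : 0 ≤ d * M * Real.sqrt 2 := by positivity
    rw [le_div_iff₀ (by positivity)] at h2
    nlinarith [chordalDist_nonneg (σ.codewords n (a n) i) (F i)]
  set Z : ℕ → ℕ → Set (Fin N → Fin M → ℂ) := fun n m =>
    {X | ‖((σ.filters (σ.codewords n (a n)) i)ᴴ * (H.mat i i + Matrix.of X) *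
      ((C i)⁻¹ * (F i)ᴴ * σ.codewords n (a n) i *
        (σ.cnQuant i).quantize m (σ.precoders (σ.codewords n (a n)) i))).det‖ <
      1 / 2 * tolerance n m ^ d} with hZ
  have hsub : ∀ n, {X | H + directLink i X ∈ σ.degenerate i n} ⊆ ⋃ m, Z n m := by
    intro n X hX
    obtain ⟨m, hX⟩ := Set.mem_iUnion.1 hX
    obtain ⟨b, hX1, hX2⟩ := Set.mem_iUnion.1 hX
    -- No ties: the optimal indices are determined by the cross links, so for each `n` only one
    -- tuple contributes to the union.
    have hb : b = a n := by
      funext j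
      by_contra hne
      have h1 := hX1 j (a n j)
      rw [stack_add_directLink] at h1
      exact hH.2 j n (b j) _ hne (le_antisymm (ha n j _) h1)
    subst hb
    rw [σ.norm_directGain_lt_iff (hF i) (hC i) (by rw [stack_add_directLink, hFC]),
      mat_add_directLink] at hX2
    exact Set.mem_iUnion.2 ⟨m, hX2⟩
  -- The segment estimate is finite only on bounded sets; countably many balls exhaust the space.
  suffices h : ∀ R : ℕ, ∀ᵐ X ∂(volume : Measure (Fin N → Fin M → ℂ)).restrict (Metric.ball 0 R),
      ∀ᶠ n in atTop, H + directLink i X ∉ σ.degenerate i n by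
    have h2 := ae_all_iff.2 fun R : ℕ => (ae_restrict_iff' measurableSet_ball).1 (h R)
    filter_upwards [h2] with X hX
    obtain ⟨R, hR⟩ := exists_nat_gt ‖X‖
    exact hX R (by rwa [mem_ball_zero_iff])
  intro R
  set b : ENNReal := volume (Metric.ball (0 : Fin N → Fin M → ℂ) (R + d * M * frob (C i))) with hb
  have hbtop : b ≠ ⊤ := measure_ball_lt_top.ne
  -- `tolerance n m` is `1 / (n + 1) ^ 2` times `1 / (m + 1) ^ 2`, so the union over all `m` has
  -- measure `O(w n)`. The index is shifted by `n₀`, beyond which quantization is fine enough.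
  set w : ℕ → ENNReal := fun n => ENNReal.ofReal (1 / (n + 1 : ℝ) ^ 2) with hw
  have hwtop : ∑' n, w n ≠ ⊤ := by
    refine Summable.tsum_ofReal_ne_top ?_
    have := (summable_nat_add_iff 1).2 (Real.summable_one_div_nat_pow.2 (le_refl 2))
    simpa using this
  have hbound : ∀ n, (volume.restrict (Metric.ball 0 R))
      {X | H + directLink i X ∈ σ.degenerate i (n + n₀)} ≤
      ENNReal.ofReal (d * 2) * b * (∑' m, w m) * w n := by
    intro n
    rw [Measure.restrict_apply' measurableSet_ball]
    calc volume ({X | H + directLink i X ∈ σ.degenerate i (n + n₀)} ∩ Metric.ball 0 R)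
        ≤ volume (⋃ m, Z (n + n₀) m ∩ Metric.ball 0 R) := by
          rw [← Set.iUnion_inter]
          exact measure_mono (Set.inter_subset_inter_left _ (hsub _))
      _ ≤ ∑' m, volume (Z (n + n₀) m ∩ Metric.ball 0 R) := measure_iUnion_le _
      _ ≤ ∑' m, ENNReal.ofReal (d * 2) * b * w n * w m := by
          refine ENNReal.tsum_le_tsum fun m => ?_
          have h1 := volume_det_lt_inter_ball_le
            (σ.filters_unitary _ (σ.truncatedUnitary_codewords (n + n₀) (a (n + n₀))) i)
            ((σ.cnQuant i).truncatedUnitary_quantize m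
              (σ.precoders (σ.codewords (n + n₀) (a (n + n₀))) i))
            (hF i) (σ.truncatedUnitary_codewords (n + n₀) (a (n + n₀)) i) (hC i) hε
            (hdist _ (Nat.le_add_left _ _)) (H.mat i i) (tolerance_pos (n + n₀) m).le R
          refine h1.trans ?_
          have h2 : ENNReal.ofReal (d * (2 * tolerance (n + n₀) m)) ≤
              ENNReal.ofReal (d * 2) * w n * w m := by
            rw [hw, ← ENNReal.ofReal_mul (by positivity), ← ENNReal.ofReal_mul (by positivity)]
            refine ENNReal.ofReal_le_ofReal ?_
            rw [tolerance, mul_assoc, mul_assoc]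
            gcongr
            linarith [(Nat.cast_nonneg n₀ : (0 : ℝ) ≤ n₀)]
          calc _ ≤ ENNReal.ofReal (d * 2) * w n * w m * b := mul_le_mul_left h2 _
            _ = _ := by ring
      _ = _ := by rw [ENNReal.tsum_mul_left]; ring
  have hsum : ∑' n, (volume.restrict (Metric.ball 0 R))
      {X | H + directLink i X ∈ σ.degenerate i (n + n₀)} ≠ ⊤ := by
    refine ne_top_of_le_ne_top ?_ (ENNReal.tsum_le_tsum hbound)
    rw [ENNReal.tsum_mul_left]
    exact ENNReal.mul_ne_top (ENNReal.mul_ne_top (ENNReal.mul_ne_top ENNReal.ofReal_ne_top hbtop)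
      hwtop) hwtop
  filter_upwards [ae_eventually_notMem hsum] with X hX
  obtain ⟨n₁, hn₁⟩ := eventually_atTop.1 hX
  refine eventually_atTop.2 ⟨n₁ + n₀, fun n hn => ?_⟩
  have h1 := hn₁ (n - n₀) (by omega)
  rwa [Nat.sub_add_cancel (by omega)] at h1

/-- The cross links are frozen at a generic channel and only the direct link of user `i` is varied.
-/
theorem ae_eventually_notMem_degenerate (i : Fin K) (hM0 : 0 < M) (hM : M < (K - 1) * N) :
    ∀ᵐ H : Channel K N M, ∀ᶠ n in atTop, H ∉ σ.degenerate i n := by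
  refine ae_of_ae_ae_add volume (volume : Measure (Fin N → Fin M → ℂ)) (continuous_directLink i)
    (p := fun H => ∀ᶠ n in atTop, H ∉ σ.degenerate i n) ?_ ?_
  · simp only [eventually_atTop, Set.ofPred_exists, Set.ofPred_forall]
    exact MeasurableSet.iUnion fun n₀ => MeasurableSet.iInter fun n => MeasurableSet.iInter fun _ =>
      (σ.measurableSet_degenerate i n).compl
  · filter_upwards [σ.ae_generic hM0 hM] with H hH
    exact σ.ae_link_eventually_notMem_degenerate i hH

/-- Outside the degenerate set, the effective direct channel is bounded away from singular
matrices, for all factorizations of the stacked channels. -/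
theorem tolerance_le_norm_det {i : Fin K} {H : Channel K N M}
    {F : (j : Fin K) → Matrix (CrossRows N j) (Fin M) ℂ} {C : Fin K → Matrix (Fin M) (Fin M) ℂ}
    (hF : ∀ j, TruncatedUnitary (F j)) (hFC : ∀ j, H.stack j = F j * C j)
    (hC : ∀ j, (C j).det ≠ 0) {P : ℝ} (h : H ∉ σ.degenerate i (bitsBS K N M P)) :
    1 / 2 * tolerance (bitsBS K N M P) (bitsCentral M d P) ^ d ≤
      ‖((σ.U F P i)ᴴ * H.mat i i * σ.V F C P i).det‖ := by
  by_contra! hcon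
  refine h (Set.mem_iUnion.2 ⟨bitsCentral M d P, Set.mem_iUnion.2
    ⟨fun j => (σ.bsQuant j).index (bitsBS K N M P) (F j), fun j b => ?_, ?_⟩⟩)
  · rw [hFC j]
    exact ((hF j).proximity_le_iff (hC j) (((σ.bsQuant j).packing _).1 _)
      (((σ.bsQuant j).packing _).1 _)).2 ((σ.bsQuant j).nearest _ _ _)
  · rw [σ.norm_directGain_lt_iff (hF i) (hC i) (hFC i)]
    exact hcon

end Scheme

end DirectLinks

/-! ### Degrees of freedom of the quantized scheme -/

section QuantizedDoF

variable {K N M d : ℕ}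

/-- The numerator is `O(log log P)`. -/
theorem tendsto_logb_floor_div {c : ℝ} (hc : 0 ≤ c) :
    Tendsto (fun P => Real.logb 2 (⌊c * Real.logb 2 P⌋₊ + 1) / Real.logb 2 P) atTop (𝓝 0) := by
  suffices h : Tendsto (fun x : ℝ => Real.logb 2 (⌊c * x⌋₊ + 1) / x) atTop (𝓝 0) from
    h.comp (Real.tendsto_logb_atTop (b := 2) (by norm_num))
  have hlog : Tendsto (fun x : ℝ => Real.logb 2 x / x) atTop (𝓝 0) := by
    have h := (Real.isLittleO_log_id_atTop.tendsto_div_nhds_zero).div_const (Real.log 2)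
    rw [zero_div] at h
    refine h.congr fun x => ?_
    rw [Real.logb, id]
    ring
  have hupp : Tendsto (fun x : ℝ => Real.logb 2 (c + 1) / x + Real.logb 2 x / x) atTop (𝓝 0) := by
    simpa using (tendsto_id.const_div_atTop (Real.logb 2 (c + 1))).add hlog
  refine squeeze_zero' ?_ ?_ hupp
  · filter_upwards [eventually_ge_atTop 1] with x hx
    have h0 : (0 : ℝ) ≤ (⌊c * x⌋₊ : ℝ) := Nat.cast_nonneg _
    exact div_nonneg (Real.logb_nonneg (by norm_num) (by linarith)) (by linarith)
  · filter_upwards [eventually_ge_atTop 1] with x hx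
    rw [← add_div, ← Real.logb_mul (by linarith) (by linarith)]
    refine div_le_div_of_nonneg_right (Real.logb_le_logb_of_le (by norm_num) (by positivity) ?_)
      (by linarith)
    have := Nat.floor_le (mul_nonneg hc (by linarith : (0 : ℝ) ≤ x))
    linarith

theorem logb_tolerance (n m : ℕ) :
    Real.logb 2 (tolerance n m) = -2 * Real.logb 2 (n + 1) + -2 * Real.logb 2 (m + 1) := by
  have hn : (n + 1 : ℝ) ≠ 0 := by positivity
  have hm : (m + 1 : ℝ) ≠ 0 := by positivity
  rw [tolerance, Real.logb_mul (by positivity) (by positivity), one_div, one_div, Real.logb_inv,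
    Real.logb_inv, Real.logb_pow, Real.logb_pow]
  push_cast
  ring

theorem tendsto_logb_tolerance_div (K N M d : ℕ) :
    Tendsto (fun P => Real.logb 2
      ((1 / 2 * tolerance (bitsBS K N M P) (bitsCentral M d P) ^ d) ^ 2) / Real.logb 2 P)
      atTop (𝓝 0) := by
  have h1 : Tendsto (fun P => Real.logb 2 ((bitsBS K N M P : ℝ) + 1) / Real.logb 2 P) atTop
      (𝓝 0) := tendsto_logb_floor_div (by positivity)
  have h2 : Tendsto (fun P => Real.logb 2 ((bitsCentral M d P : ℝ) + 1) / Real.logb 2 P) atTop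
      (𝓝 0) := tendsto_logb_floor_div (by positivity)
  have h3 : Tendsto (fun P => (2 * Real.logb 2 (1 / 2)) / Real.logb 2 P) atTop (𝓝 0) :=
    (Real.tendsto_logb_atTop (by norm_num)).const_div_atTop _
  have h := h3.add ((h1.const_mul (-4 * (d : ℝ))).add (h2.const_mul (-4 * (d : ℝ))))
  simp only [mul_zero, add_zero] at h
  refine h.congr fun P => ?_
  have ht := tolerance_pos (bitsBS K N M P) (bitsCentral M d P)
  rw [Real.logb_pow, Real.logb_mul (by norm_num) (by positivity), Real.logb_pow, logb_tolerance]
  push_cast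
  ring

/-- Only the base station bits must grow; those of the central node stay zero when `d = M`, and
`degenerate` takes the union over all `m`. -/
theorem tendsto_bitsBS (hM0 : 0 < M) (hM : M < (K - 1) * N) :
    Tendsto (fun P => bitsBS K N M P) atTop atTop := by
  have hG : 0 < grassmannDim ((K - 1) * N) M := by
    unfold grassmannDim
    have : 0 < (K - 1) * N - M := by omega
    positivity
  have hG' : (0 : ℝ) < (grassmannDim ((K - 1) * N) M : ℝ) / 2 := by positivity
  exact tendsto_nat_floor_atTop.comp
    ((Real.tendsto_logb_atTop (b := 2) (by norm_num)).const_mul_atTop hG')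

theorem Scheme.frob_direct_le (σ : Scheme K N M d) (H : Channel K N M)
    {F : (j : Fin K) → Matrix (CrossRows N j) (Fin M) ℂ} {C : Fin K → Matrix (Fin M) (Fin M) ℂ}
    (hF : ∀ j, TruncatedUnitary (F j)) (P : ℝ) (i : Fin K) :
    frob ((σ.U F P i)ᴴ * H.mat i i * σ.V F C P i) ≤
      Real.sqrt d * frob (H.mat i i) * (frob (C i)⁻¹ * Real.sqrt M * Real.sqrt M * Real.sqrt d) := by
  have h1 : frob (σ.V F C P i) ≤ frob (C i)⁻¹ * Real.sqrt M * Real.sqrt M * Real.sqrt d := by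
    rw [Scheme.V]
    calc _ ≤ frob ((C i)⁻¹ * (F i)ᴴ) * frob (σ.Fhat F P i) * frob (σ.Vhat F P i) :=
          frob_mul₃_le _ _ _
      _ ≤ frob (C i)⁻¹ * frob (F i)ᴴ * frob (σ.Fhat F P i) * frob (σ.Vhat F P i) := by
          have := frob_nonneg (σ.Fhat F P i)
          have := frob_nonneg (σ.Vhat F P i)
          have := frob_mul_le (C i)⁻¹ (F i)ᴴ
          gcongr
      _ = _ := by
          rw [frob_conjTranspose, (hF i).frob_eq, (σ.truncatedUnitary_Fhat F P i).frob_eq,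
            (σ.truncatedUnitary_Vhat F P i).frob_eq]
  refine (frob_mul₃_le _ _ _).trans ?_
  rw [frob_conjTranspose, (σ.truncatedUnitary_U F P i).frob_eq]
  have := frob_nonneg (H.mat i i)
  gcongr

theorem Scheme.ae_hasDoF (σ : Scheme K N M d) (hd : 0 < d) (hM0 : 0 < M) (hM : M < (K - 1) * N)
    {c₀ : ℝ} (hc₀ : ∀ (H : Channel K N M) (F : (j : Fin K) → Matrix (CrossRows N j) (Fin M) ℂ)
      (C : Fin K → Matrix (Fin M) (Fin M) ℂ), (∀ j, TruncatedUnitary (F j)) →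
      (∀ j, H.stack j = F j * C j) → (∀ j, (C j).det ≠ 0) →
      ∀ i, ∀ P : ℝ, 1 ≤ P → leakage H (σ.U F P) (σ.V F C P) P i ≤ c₀) :
    ∀ᵐ H : Channel K N M, ∀ (F : (j : Fin K) → Matrix (CrossRows N j) (Fin M) ℂ)
      (C : Fin K → Matrix (Fin M) (Fin M) ℂ), (∀ j, TruncatedUnitary (F j)) →
      (∀ j, H.stack j = F j * C j) →
      (∀ i, ∀ P : ℝ, 1 ≤ P → leakage H (σ.U F P) (σ.V F C P) P i ≤ c₀) ∧
      (∀ i, HasDoF (fun P => rate H (σ.U F P) (σ.V F C P) P i) d) := by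
  -- The exceptional null set is fixed before the factorization `F`, `C` is introduced.
  filter_upwards [ae_all_iff.2 fun j => ae_det_gram_ne_zero hM.le j,
    ae_all_iff.2 fun i => σ.ae_eventually_notMem_degenerate i hM0 hM] with H hdet hdeg F C hF hFC
  have hC : ∀ j, (C j).det ≠ 0 := fun j =>
    det_ne_zero_of_det_gram_ne_zero (hF j) (by rw [← hFC]; exact hdet j)
  have hleak := hc₀ H F C hF hFC hC
  refine ⟨hleak, fun i => hasDoF_of_bounds hd (c₀ := c₀) (c₁ := (Real.sqrt d * frob (H.mat i i) *
    (frob (C i)⁻¹ * Real.sqrt M * Real.sqrt M * Real.sqrt d)) ^ 2) ?_ ?_ ?_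
    (tendsto_logb_tolerance_div K N M d)⟩
  · filter_upwards [eventually_ge_atTop 1] with P hP
    exact hleak i P hP
  · exact Eventually.of_forall fun P =>
      pow_le_pow_left₀ (frob_nonneg _) (σ.frob_direct_le H hF P i) 2
  · filter_upwards [(tendsto_bitsBS hM0 hM).eventually (hdeg i)] with P hP
    have ht := tolerance_pos (bitsBS K N M P) (bitsCentral M d P)
    exact ⟨by positivity, pow_le_pow_left₀ (by positivity) (σ.tolerance_le_norm_det hF hFC hC hP) 2⟩

end QuantizedDoF

end CSITSharing

end

theorem theorem1 (K N M d : ℕ) (hd : 0 < d) (hM : M < (K - 1) * N)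
    (hfeas : CSITSharing.IAFeasible K N M d) :
    (∃ σ : CSITSharing.Scheme K N M d, σ.Optimal) ∧
    (∃ c₀ : ℝ, ∀ σ : CSITSharing.Scheme K N M d, ∀ᵐ H : CSITSharing.Channel K N M,
      ∀ (F : (j : Fin K) → Matrix (CSITSharing.CrossRows N j) (Fin M) ℂ)
        (C : Fin K → Matrix (Fin M) (Fin M) ℂ),
        (∀ j, CSITSharing.TruncatedUnitary (F j)) →
        (∀ j, H.stack j = F j * C j) →
        (∀ i, ∀ P : ℝ, 1 ≤ P → CSITSharing.leakage H (σ.U F P) (σ.V F C P) P i ≤ c₀) ∧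
        (∀ i, CSITSharing.HasDoF
          (fun P => CSITSharing.rate H (σ.U F P) (σ.V F C P) P i) d)) ∧
    (∀ (H : CSITSharing.Channel K N M) (U : Fin K → Matrix (Fin N) (Fin d) ℂ)
      (V : Fin K → Matrix (Fin M) (Fin d) ℂ),
      (∀ i, CSITSharing.TruncatedUnitary (U i)) → (∀ i, CSITSharing.TruncatedUnitary (V i)) →
      CSITSharing.IsIASolution H U V →
      ∀ i, CSITSharing.HasDoF (fun P => CSITSharing.rate H U V P i) d) := by
  refine ⟨hfeas.exists_optimal_scheme hM, ?_, fun H U V _ _ h i => h.hasDoF hd i⟩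
  have hK : 0 < K := by
    rcases K.eq_zero_or_pos with h | h
    · subst h; simp at hM
    · exact h
  have hM0 : 0 < M := hd.trans_le (hfeas.le hK)
  obtain ⟨c₀, hc₀⟩ := CSITSharing.exists_leakage_bound K N M d
  exact ⟨c₀, fun σ => σ.ae_hasDoF hd hM0 hM (hc₀ σ)⟩
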